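/- Let $T\ge 0$ and let $x_0,\dots,x_T$ be a Gauss--Markov process, $x_t\in\mathbb R^{n_t}$, given by $x_{t+1}=A_tx_t+w_t$ for $0\le t\le T-1$, where $x_0\sim\mathcal N(0,P_0)$ with $P_0\succ0$ and $w_t\sim\mathcal N(0,W_t)$ with $W_t\succ0$ are mutually independent. For $1\le t\le T$ let $\Theta_t\succeq0$ be an $n_t\times n_t$ matrix, $\|v\|_{\Theta_t}^2=v^\top\Theta_tv$, and let $D_t\in\mathbb R$. Write $y^t=(y_1,\dots,y_t)$ and $z^t=(z_1,\dots,z_t)$. Consider two problems. (P-1): minimize $\sum_{t=1}^T I(x_t;z_t\mid z^{t-1})$ subject to $\mathbb E\|x_t-z_t\|_{\Theta_t}^2\le D_t$ for $t=1,\dots,T$, over all linear-Gaussian kernels $$z_t=E_tx_t+F_{t,t-1}z_{t-1}+\dots+F_{t,1}z_1+g_t,\qquad t=1,\dots,T,$$ where $z_t\in\mathbb R^{n_t}$, the $E_t,F_{t,s}$ are matrices, and the $g_t$ are zero-mean, possibly degenerate Gaussian vectors, mutually independent and independent of $x_0,w_0,\dots,w_{T-1}$. (P-LGS): minimize $\sum_{t=1}^T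 I(x_t;y_t\mid y^{t-1})$ subject to $\mathbb E\|x_t-z_t\|_{\Theta_t}^2\le D_t$ for $t=1,\dots,T$, over all sensors $$y_t=C_tx_t+v_t,\qquad t=1,\dots,T,$$ where $C_t\in\mathbb R^{r_t\times n_t}$, the $v_t\sim\mathcal N(0,V_t)$ with $V_t\succ0$ are mutually independent and independent of $x_0,w_0,\dots,w_{T-1}$, the dimensions $r_t\ge0$ are free, and $z_t=\mathbb E(x_t\mid y^t)$ is the Kalman filter estimate. (i) For every kernel that is feasible for (P-1) with objective value $f_1<+\infty$ there is a sensor that is feasible for (P-LGS) with objective value $f_{\mathrm{LGS}}\le f_1$; moreover it can be chosen so that its distortion $\mathbb E\|x_t-z_t\|_{\Theta_t}^2$ is, for every $t=1,\dots,T$, at most that of the given kernel. (ii) For every sensor that is feasible for (P-LGS) with objective value $f_{\mathrm{LGS}}<+\infty$, there is a linear-Gaussian kernel of the above form that induces the same joint law of $(x_0,\dots,x_T,z_1,\dots,z_T)$, is feasible for (P-1), and has objective value $f_1\le f_{\mathrm{LGS}}$. -/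

import Mathlib

open MeasureTheory ProbabilityTheory InformationTheory Matrix
open scoped ENNReal

namespace GaussSRD

noncomputable section

/-- `n`-dimensional Euclidean space. -/
abbrev Vec (n : ℕ) : Type := EuclideanSpace ℝ (Fin n)

/-- The squared weighted norm `‖v‖_Θ² = vᵀ Θ v`. -/
def weightedSq {n : ℕ} (Θ : Matrix (Fin n) (Fin n) ℝ) (v : Vec n) : ℝ :=
  v.ofLp ⬝ᵥ (Θ *ᵥ v.ofLp)

/-! ### Information quantities -/

/-- Conditional mutual information `I(X; Y | Z)`, with values in `[0, ∞]`: the average over the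
law of `Z` of the relative entropy from the conditional law of `(X, Y)` given `Z` to the product
of the conditional laws of `X` and of `Y` given `Z`. -/
def condMutualInfo {Ω α β κ : Type*} [MeasurableSpace Ω]
    [MeasurableSpace α] [StandardBorelSpace α] [Nonempty α]
    [MeasurableSpace β] [StandardBorelSpace β] [Nonempty β] [MeasurableSpace κ]
    (μ : Measure Ω) [IsFiniteMeasure μ] (X : Ω → α) (Y : Ω → β) (Z : Ω → κ) : ℝ≥0∞ :=
  ∫⁻ c, klDiv (condDistrib (fun ω => (X ω, Y ω)) Z μ c)
    ((condDistrib X Z μ c).prod (condDistrib Y Z μ c)) ∂(μ.map Z)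

/-- The family `(Y_s)_{s ∈ I}` as a single random element. `Y^{t-1} = (Y_1, …, Y_{t-1})` is the
case `I = Finset.Ico 1 t`, and `Y^t = (Y_1, …, Y_t)` is the case `I = Finset.Icc 1 t`. -/
def history {Ω : Type*} {d : ℕ → ℕ} (Y : (t : ℕ) → Ω → Vec (d t)) (I : Finset ℕ) :
    Ω → ((s : I) → Vec (d s)) :=
  fun ω s => Y s ω

/-- The information cost `∑_{t=1}^T I(X_t; Y_t | Y^{t-1})`. -/
def informationCost {Ω : Type*} [MeasurableSpace Ω] (μ : Measure Ω) [IsFiniteMeasure μ]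
    {n d : ℕ → ℕ} (T : ℕ) (X : (t : ℕ) → Ω → Vec (n t)) (Y : (t : ℕ) → Ω → Vec (d t)) : ℝ≥0∞ :=
  ∑ t ∈ Finset.Icc 1 T, condMutualInfo μ (X t) (Y t) (history Y (Finset.Ico 1 t))

/-- The distortion `𝔼 ‖X - Z‖_Θ²`, with values in `[0, ∞]`. -/
def distortion {Ω : Type*} [MeasurableSpace Ω] (μ : Measure Ω) {n : ℕ}
    (Θ : Matrix (Fin n) (Fin n) ℝ) (X Z : Ω → Vec n) : ℝ≥0∞ :=
  ∫⁻ ω, ENNReal.ofReal (weightedSq Θ (X ω - Z ω)) ∂μ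

/-- The joint law of `(X_0, …, X_T)` and `(Z_1, …, Z_T)`. -/
def jointLaw {Ω : Type*} [MeasurableSpace Ω] (μ : Measure Ω) {n : ℕ → ℕ} (T : ℕ)
    (X Z : (t : ℕ) → Ω → Vec (n t)) :
    Measure (((s : Finset.Icc 0 T) → Vec (n s)) × ((s : Finset.Icc 1 T) → Vec (n s))) :=
  μ.map fun ω => (history X (Finset.Icc 0 T) ω, history Z (Finset.Icc 1 T) ω)

/-! ### The source -/

/-- The data of a Gauss-Markov source `x_{t+1} = A_t x_t + w_t`, `t = 0, …, T - 1`, with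
`x_t ∈ ℝ^{n_t}`, `x_0 ∼ N(0, P_0)`, `P_0 ≻ 0`, `w_t ∼ N(0, W_t)`, `W_t ≻ 0`. Entries of the
sequences outside the horizon play no role. -/
structure Source (T : ℕ) (n : ℕ → ℕ) where
  A : (t : ℕ) → Matrix (Fin (n (t + 1))) (Fin (n t)) ℝ
  P₀ : Matrix (Fin (n 0)) (Fin (n 0)) ℝ
  P₀_posDef : P₀.PosDef
  W : (t : ℕ) → Matrix (Fin (n (t + 1))) (Fin (n (t + 1))) ℝ
  W_posDef : ∀ t < T, (W t).PosDef

/-- Covariances of the independent inputs of the source: index `0` is the initial state `x_0` and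
index `t + 1` is the noise `w_t`. -/
def Source.inputCov {T : ℕ} {n : ℕ → ℕ} (S : Source T n) :
    (t : ℕ) → Matrix (Fin (n t)) (Fin (n t)) ℝ
  | 0 => S.P₀
  | t + 1 => S.W t

/-- Sample points: a sequence of source inputs (`x_0, w_0, w_1, …`) together with a sequence of
additional noise vectors of dimensions `d t` (the noise `g_t` of a reproduction kernel or the
noise `v_t` of a sensor). -/
abbrev Sample (n d : ℕ → ℕ) : Type := ((t : ℕ) → Vec (n t)) × ((t : ℕ) → Vec (d t))

/-- The probability measure under which all source inputs and all additional noise vectors are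
mutually independent, centred and Gaussian, the additional noise at time `t` having
covariance `N t`. -/
def noiseMeasure {T : ℕ} {n : ℕ → ℕ} (S : Source T n) {d : ℕ → ℕ}
    (N : (t : ℕ) → Matrix (Fin (d t)) (Fin (d t)) ℝ) : Measure (Sample n d) :=
  (Measure.infinitePi fun t => multivariateGaussian (0 : Vec (n t)) (S.inputCov t)).prod
    (Measure.infinitePi fun t => multivariateGaussian (0 : Vec (d t)) (N t))

instance {T : ℕ} {n : ℕ → ℕ} (S : Source T n) {d : ℕ → ℕ}
    (N : (t : ℕ) → Matrix (Fin (d t)) (Fin (d t)) ℝ) :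
    IsProbabilityMeasure (noiseMeasure S N) := by
  unfold noiseMeasure
  infer_instance

/-- The state `x_t` of the source. -/
def Source.x {T : ℕ} {n : ℕ → ℕ} (S : Source T n) {d : ℕ → ℕ} :
    (t : ℕ) → Sample n d → Vec (n t)
  | 0 => fun ω => ω.1 0
  | t + 1 => fun ω => Matrix.toEuclideanLin (S.A t) (S.x t ω) + ω.1 (t + 1)

/-! ### Linear-Gaussian reproduction kernels and the problem (P-1) -/

/-- A sequence of linear-Gaussian kernels
`z_t = E_t x_t + F_{t,t-1} z_{t-1} + ⋯ + F_{t,1} z_1 + g_t`, `t = 1, …, T`, where `g_t` is centred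
Gaussian with a possibly singular covariance `G_t`. -/
structure LinearGaussianKernel (T : ℕ) (n : ℕ → ℕ) where
  E : (t : ℕ) → Matrix (Fin (n t)) (Fin (n t)) ℝ
  F : (t s : ℕ) → Matrix (Fin (n t)) (Fin (n s)) ℝ
  G : (t : ℕ) → Matrix (Fin (n t)) (Fin (n t)) ℝ
  G_posSemidef : ∀ t ∈ Finset.Icc 1 T, (G t).PosSemidef

namespace LinearGaussianKernel

variable {T : ℕ} {n : ℕ → ℕ} (S : Source T n) (γ : LinearGaussianKernel T n)

/-- The underlying probability measure: the additional noise is `g_t ∼ N(0, G_t)`. -/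
abbrev μ : Measure (Sample n n) := noiseMeasure S γ.G

/-- The reproduction `z_t` (used for `1 ≤ t ≤ T` only). -/
def z (t : ℕ) (ω : Sample n n) : Vec (n t) :=
  Matrix.toEuclideanLin (γ.E t) (S.x t ω)
    + ∑ s ∈ (Finset.Ico 1 t).attach, Matrix.toEuclideanLin (γ.F t s.1) (z s.1 ω)
    + ω.2 t
termination_by t
decreasing_by exact (Finset.mem_Ico.1 s.2).2

/-- The defining equation of the reproduction. -/
theorem z_eq (t : ℕ) (ω : Sample n n) :
    γ.z S t ω = Matrix.toEuclideanLin (γ.E t) (S.x t ω)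
      + ∑ s ∈ Finset.Ico 1 t, Matrix.toEuclideanLin (γ.F t s) (γ.z S s ω) + ω.2 t := by
  rw [z, Finset.sum_attach (Finset.Ico 1 t)
    (fun s => Matrix.toEuclideanLin (γ.F t s) (γ.z S s ω))]

/-- The objective `∑_{t=1}^T I(x_t; z_t | z^{t-1})` of (P-1). -/
def cost : ℝ≥0∞ := informationCost (γ.μ S) T S.x (γ.z S)

/-- The distortion `𝔼 ‖x_t - z_t‖_{Θ_t}²`. -/
def dist (Θ : (t : ℕ) → Matrix (Fin (n t)) (Fin (n t)) ℝ) (t : ℕ) : ℝ≥0∞ :=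
  distortion (γ.μ S) (Θ t) (S.x t) (γ.z S t)

/-- Feasibility for (P-1): `𝔼 ‖x_t - z_t‖_{Θ_t}² ≤ D_t` for `t = 1, …, T`. -/
def Feasible (Θ : (t : ℕ) → Matrix (Fin (n t)) (Fin (n t)) ℝ) (D : ℕ → ℝ) : Prop :=
  ∀ t ∈ Finset.Icc 1 T, (γ.dist S Θ t : EReal) ≤ (D t : EReal)

/-- The joint law of `(x_0, …, x_T)` and `(z_1, …, z_T)`. -/
def law : Measure (((s : Finset.Icc 0 T) → Vec (n s)) × ((s : Finset.Icc 1 T) → Vec (n s))) :=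
  jointLaw (γ.μ S) T S.x (γ.z S)

end LinearGaussianKernel

/-! ### Linear-Gaussian sensors and the problem (P-LGS) -/

/-- A linear-Gaussian sensor `y_t = C_t x_t + v_t`, `t = 1, …, T`, with `C_t ∈ ℝ^{r_t × n_t}` and
`v_t ∼ N(0, V_t)`, `V_t ≻ 0`. The output dimensions `r_t ≥ 0` are part of the sensor. -/
structure Sensor (T : ℕ) (n : ℕ → ℕ) where
  r : ℕ → ℕ
  C : (t : ℕ) → Matrix (Fin (r t)) (Fin (n t)) ℝ
  V : (t : ℕ) → Matrix (Fin (r t)) (Fin (r t)) ℝ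
  V_posDef : ∀ t ∈ Finset.Icc 1 T, (V t).PosDef

namespace Sensor

variable {T : ℕ} {n : ℕ → ℕ} (S : Source T n) (σ : Sensor T n)

/-- The underlying probability measure: the additional noise is `v_t ∼ N(0, V_t)`. -/
abbrev μ : Measure (Sample n σ.r) := noiseMeasure S σ.V

/-- The sensor output `y_t = C_t x_t + v_t`. -/
def y (t : ℕ) (ω : Sample n σ.r) : Vec (σ.r t) :=
  Matrix.toEuclideanLin (σ.C t) (S.x t ω) + ω.2 t

/-- The least mean square error estimate (Kalman filter) `z_t = 𝔼[x_t | y_1, …, y_t]`. -/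
def z (t : ℕ) : Sample n σ.r → Vec (n t) :=
  (σ.μ S)[S.x t | MeasurableSpace.comap (history (σ.y S) (Finset.Icc 1 t)) inferInstance]

/-- The objective `∑_{t=1}^T I(x_t; y_t | y^{t-1})` of (P-LGS). -/
def cost : ℝ≥0∞ := informationCost (σ.μ S) T S.x (σ.y S)

/-- The distortion `𝔼 ‖x_t - z_t‖_{Θ_t}²`. -/
def dist (Θ : (t : ℕ) → Matrix (Fin (n t)) (Fin (n t)) ℝ) (t : ℕ) : ℝ≥0∞ :=
  distortion (σ.μ S) (Θ t) (S.x t) (σ.z S t)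

/-- Feasibility for (P-LGS): `𝔼 ‖x_t - z_t‖_{Θ_t}² ≤ D_t` for `t = 1, …, T`. -/
def Feasible (Θ : (t : ℕ) → Matrix (Fin (n t)) (Fin (n t)) ℝ) (D : ℕ → ℝ) : Prop :=
  ∀ t ∈ Finset.Icc 1 T, (σ.dist S Θ t : EReal) ≤ (D t : EReal)

/-- The joint law of `(x_0, …, x_T)` and `(z_1, …, z_T)`. -/
def law : Measure (((s : Finset.Icc 0 T) → Vec (n s)) × ((s : Finset.Icc 1 T) → Vec (n s))) :=
  jointLaw (σ.μ S) T S.x (σ.z S)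

end Sensor

end

end GaussSRD

-- Both directions rest on explicit linear maps between the noise spaces, on the Kalman filter, and
-- on one form of data processing.
--
-- Kalman filter (`Sensor.filterSpec`). The gain makes the new error uncorrelated with the
-- innovation, hence independent of it, since the two are jointly Gaussian. By induction the error
-- `e_t` is centred Gaussian and independent of `y^t`, so the recursive filter is the conditional
-- mean. Any other estimator computed from `y^t` has error `e_t + H` with `H` independent of `e_t`,
-- and this cannot lower the weighted second moment (`lintegral_weightedSq_le_add`).
--
-- Sensor to kernel. Inserting `y_t = C_t x_t + v_t` in the filter recursion exhibits the estimates
-- as a linear-Gaussian kernel with `E = K C`, noise `K v` and feedback from the last estimate only.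
-- Given `y^{t-1}`, the law of `(x_t, y_t)` depends only on the last estimate, and the new estimate
-- is a function of that one and of `y_t`; so `condMutualInfo_le` bounds the cost.
--
-- Kernel to sensor. Suppose that `aᵀ G_t = 0` but `b = E_tᵀ a ≠ 0`. Then `z^t` reveals `bᵀ x_t`
-- exactly, although given `z^{t-1}` this functional has no atoms, because `W_{t-1} ≻ 0`. The joint
-- law is then not absolutely continuous with respect to the product, and the information is
-- infinite. Finite cost therefore puts the range of `E_t` inside that of `G_t`
-- (`LinearGaussianKernel.mul_E_eq_zero`). With `U_t` an orthonormal basis of the range of `G_t`,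
-- the sensor `y_t = U_tᵀ (E_t x_t + g_t)` has nonsingular noise, and `y^t` and `z^t` determine each
-- other almost surely. So the cost does not grow, and the filter, competing with `z_t` as an
-- estimator from `y^t`, does not increase the distortion.

namespace GaussSRD

-- Conditional laws and data processing.

section Generic

/-- The joint law is a fourfold product whose factors may be permuted. This merges past-versus-next
independence of the source inputs with that of the additional noise. -/
theorem indepFun_prod_prodMk {α β A A' B B' : Type*} [MeasurableSpace α] [MeasurableSpace β]
    [MeasurableSpace A] [MeasurableSpace A'] [MeasurableSpace B] [MeasurableSpace B']
    {μ : Measure α} {ν : Measure β} [IsProbabilityMeasure μ] [IsProbabilityMeasure ν]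
    {f : α → A} {f' : α → A'} {g : β → B} {g' : β → B'}
    (hf : Measurable f) (hf' : Measurable f') (hg : Measurable g) (hg' : Measurable g')
    (h₁ : IndepFun f f' μ) (h₂ : IndepFun g g' ν) :
    IndepFun (fun ω : α × β => (f ω.1, g ω.2)) (fun ω => (f' ω.1, g' ω.2)) (μ.prod ν) := by
  rw [indepFun_iff_map_prod_eq_prod_map_map (by fun_prop) (by fun_prop)] at h₁ h₂ ⊢
  have e₁ : (μ.prod ν).map (fun ω : α × β => (f ω.1, g ω.2)) = (μ.map f).prod (ν.map g) :=
    (Measure.map_prod_map μ ν hf hg).symm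
  have e₂ : (μ.prod ν).map (fun ω : α × β => (f' ω.1, g' ω.2)) = (μ.map f').prod (ν.map g') :=
    (Measure.map_prod_map μ ν hf' hg').symm
  have := Measure.isProbabilityMeasure_map (μ := μ) hf.aemeasurable
  have := Measure.isProbabilityMeasure_map (μ := μ) hf'.aemeasurable
  have := Measure.isProbabilityMeasure_map (μ := ν) hg.aemeasurable
  have := Measure.isProbabilityMeasure_map (μ := ν) hg'.aemeasurable
  have e₃ : (μ.prod ν).map (fun ω : α × β => ((f ω.1, g ω.2), (f' ω.1, g' ω.2)))
      = ((((μ.map f).prod (μ.map f')).prod ((ν.map g).prod (ν.map g')))).map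
        (fun p => ((p.1.1, p.2.1), (p.1.2, p.2.2))) := by
    rw [← h₁, ← h₂, Measure.map_prod_map μ ν (by fun_prop) (by fun_prop),
      Measure.map_map (by fun_prop) (by fun_prop)]
    rfl
  rw [e₁, e₂, e₃]
  refine Measure.ext_of_lintegral _ fun F hF => ?_
  rw [lintegral_map hF (by fun_prop), lintegral_prod _ (by fun_prop),
    lintegral_prod _ (by fun_prop), lintegral_prod _ (by fun_prop), lintegral_prod _ (by fun_prop)]
  refine lintegral_congr fun a => ?_
  have e : ∀ a', ∫⁻ z, F ((a, z.1), (a', z.2)) ∂((ν.map g).prod (ν.map g'))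
      = ∫⁻ b, ∫⁻ b', F ((a, b), (a', b')) ∂(ν.map g') ∂(ν.map g) := fun a' =>
    lintegral_prod _ (by fun_prop)
  simp only [e]
  rw [lintegral_lintegral_swap (Measurable.aemeasurable (by fun_prop))]
  refine lintegral_congr fun b => ?_
  rw [lintegral_prod _ (by fun_prop)]

variable {Ω α β κ κ' : Type*} [MeasurableSpace Ω] [MeasurableSpace α] [MeasurableSpace β]
  [MeasurableSpace κ] [MeasurableSpace κ'] {μ : Measure Ω}

/-- The conditional law of `f (Z, U)` given `Z`, in terms of that of `U`. -/
theorem condDistrib_comp_prodMk [IsFiniteMeasure μ] [StandardBorelSpace α] [Nonempty α]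
    [StandardBorelSpace β] [Nonempty β] {Z : Ω → κ} {U : Ω → α} (hZ : Measurable Z)
    (hU : Measurable U) {f : κ × α → β} (hf : Measurable f) :
    ∀ᵐ c ∂(μ.map Z), condDistrib (fun ω => f (Z ω, U ω)) Z μ c
      = (condDistrib U Z μ c).map (fun u => f (c, u)) := by
  -- A kernel that disintegrates the joint law is the conditional law almost everywhere; the factor
  -- `Kernel.id` carries `c` along so that `f` can use it.
  have h := condDistrib_ae_eq_of_measure_eq_compProd (μ := μ) Z
    (Y := fun ω => f (Z ω, U ω)) (by fun_prop)
    (κ := (Kernel.id ×ₖ condDistrib U Z μ).map f) ?_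
  · filter_upwards [h] with c hc
    rw [hc, Kernel.map_apply _ hf, Kernel.prod_apply, Kernel.id_apply, Measure.dirac_prod,
      Measure.map_map hf (by fun_prop)]
    rfl
  · have h₁ := compProd_map_condDistrib (mβ := inferInstance) (μ := μ) (X := Z) hU.aemeasurable
    refine Measure.ext_of_lintegral _ fun F hF => ?_
    rw [lintegral_map hF (by fun_prop), Measure.lintegral_compProd hF]
    simp_rw [Kernel.map_apply _ hf, Kernel.prod_apply, Kernel.id_apply, Measure.dirac_prod]
    have : ∀ c, ∫⁻ b, F (c, b) ∂(((condDistrib U Z μ c).map (Prod.mk c)).map f)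
        = ∫⁻ u, F (c, f (c, u)) ∂(condDistrib U Z μ c) := fun c => by
      rw [Measure.map_map hf (by fun_prop), lintegral_map (by fun_prop) (by fun_prop)]; rfl
    simp_rw [this]
    rw [← Measure.lintegral_compProd (f := fun p : κ × α => F (p.1, f p)) (by fun_prop), h₁,
      lintegral_map (by fun_prop) (by fun_prop)]

/-- The conditional law given `Z` of a pair whose second entry is independent of the rest. -/
theorem condDistrib_prodMk_of_indepFun [IsProbabilityMeasure μ] [StandardBorelSpace α] [Nonempty α]
    [StandardBorelSpace β] [Nonempty β] {Z : Ω → κ} {U : Ω → α} {N : Ω → β} (hZ : Measurable Z)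
    (hU : Measurable U) (hN : Measurable N) (h : IndepFun (fun ω => (Z ω, U ω)) N μ) :
    ∀ᵐ c ∂(μ.map Z), condDistrib (fun ω => (U ω, N ω)) Z μ c
      = (condDistrib U Z μ c).prod (μ.map N) := by
  have := Measure.isProbabilityMeasure_map (μ := μ) hN.aemeasurable
  have h' := condDistrib_ae_eq_of_measure_eq_compProd (μ := μ) Z
    (Y := fun ω => (U ω, N ω)) (by fun_prop)
    (κ := condDistrib U Z μ ×ₖ Kernel.const κ (μ.map N)) ?_
  · filter_upwards [h'] with c hc
    rw [hc, Kernel.prod_apply, Kernel.const_apply]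
  · have h₁ := compProd_map_condDistrib (mβ := inferInstance) (μ := μ) (X := Z) hU.aemeasurable
    rw [indepFun_iff_map_prod_eq_prod_map_map (by fun_prop) (by fun_prop)] at h
    have e : μ.map (fun ω => (Z ω, (U ω, N ω)))
        = (μ.map (fun ω => ((Z ω, U ω), N ω))).map (fun p => (p.1.1, (p.1.2, p.2))) := by
      rw [Measure.map_map (by fun_prop) (by fun_prop)]; rfl
    rw [e, h, ← h₁]
    refine Measure.ext_of_lintegral _ fun F hF => ?_
    rw [lintegral_map hF (by fun_prop), lintegral_prod _ (by fun_prop),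
      Measure.lintegral_compProd (by fun_prop), Measure.lintegral_compProd (by fun_prop)]
    simp_rw [Kernel.prod_apply, Kernel.const_apply]
    refine lintegral_congr fun c => ?_
    rw [lintegral_prod _ (by fun_prop)]

/-- Data processing: if the conditional law of `(X, Y)` given `Z` depends only on the coarser
`Z' = φ Z`, and `Y'` is a function of `Z'` and `Y`, then `I(X; Y' | Z') ≤ I(X; Y | Z)`. -/
theorem condMutualInfo_le [IsFiniteMeasure μ] [StandardBorelSpace α] [Nonempty α]
    [StandardBorelSpace β] [Nonempty β] {β' : Type*} [MeasurableSpace β'] [StandardBorelSpace β']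
    [Nonempty β'] {X : Ω → α} {Y : Ω → β} {Y' : Ω → β'} {Z : Ω → κ} {Z' : Ω → κ'}
    (hX : Measurable X) (hY : Measurable Y) (hZ : Measurable Z)
    {φ : κ → κ'} (hφ : Measurable φ) (hZ' : Z' =ᵐ[μ] fun ω => φ (Z ω))
    {η : Kernel κ' (α × β)} [IsFiniteKernel η]
    (hη : ∀ᵐ c ∂(μ.map Z), condDistrib (fun ω => (X ω, Y ω)) Z μ c = η (φ c))
    {h : κ' × β → β'} (hh : Measurable h) (hY' : Y' =ᵐ[μ] fun ω => h (Z' ω, Y ω)) :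
    condMutualInfo μ X Y' Z' ≤ condMutualInfo μ X Y Z := by
  have hY'' : Y' =ᵐ[μ] fun ω => h (φ (Z ω), Y ω) := by
    filter_upwards [hZ', hY'] with ω h1 h2
    rw [h2, h1]
  have hXY'' : (fun ω => (X ω, Y' ω)) =ᵐ[μ] fun ω => (X ω, h (φ (Z ω), Y ω)) := by
    filter_upwards [hY''] with ω h1
    rw [h1]
  unfold condMutualInfo
  rw [condDistrib_congr hXY'' hZ', condDistrib_congr (.refl _ X) hZ', condDistrib_congr hY'' hZ',
    Measure.map_congr hZ']
  have hZφ : Measurable fun ω => φ (Z ω) := by fun_prop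
  -- Disintegrating over `Z` and pushing forward by `φ` shows that `η` is also the conditional law
  -- given the coarser variable.
  have key : condDistrib (fun ω => (X ω, Y ω)) (fun ω => φ (Z ω)) μ
      =ᵐ[μ.map fun ω => φ (Z ω)] η := by
    refine condDistrib_ae_eq_of_measure_eq_compProd _ (by fun_prop) ?_
    have h₁ := compProd_map_condDistrib (mβ := inferInstance) (μ := μ) (X := Z) (Y := fun ω => (X ω, Y ω))
      (by fun_prop)
    refine Measure.ext_of_lintegral _ fun F hF => ?_
    have e : ∫⁻ p, F (φ p.1, p.2) ∂(μ.map fun ω => (Z ω, (X ω, Y ω)))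
        = ∫⁻ ω, F (φ (Z ω), (X ω, Y ω)) ∂μ := lintegral_map (by fun_prop) (by fun_prop)
    rw [lintegral_map hF (by fun_prop), ← e, ← h₁, Measure.lintegral_compProd (by fun_prop),
      Measure.lintegral_compProd (by fun_prop)]
    have e₂ : μ.map (fun ω => φ (Z ω)) = (μ.map Z).map φ :=
      (Measure.map_map hφ hZ).symm
    rw [e₂, lintegral_map (Measurable.lintegral_kernel_prod_right' hF) hφ]
    refine lintegral_congr_ae ?_
    filter_upwards [hη] with c hc
    rw [hc]
  have k₁ := condDistrib_comp_prodMk (μ := μ) (Z := fun ω => φ (Z ω)) (U := fun ω => (X ω, Y ω))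
    (f := fun p => (p.2.1, h (p.1, p.2.2))) (by fun_prop) (by fun_prop) (by fun_prop)
  have k₂ := condDistrib_comp_prodMk (μ := μ) (Z := fun ω => φ (Z ω)) (U := fun ω => (X ω, Y ω))
    (f := fun p => p.2.1) (by fun_prop) (by fun_prop) (by fun_prop)
  have k₃ := condDistrib_comp_prodMk (μ := μ) (Z := fun ω => φ (Z ω)) (U := fun ω => (X ω, Y ω))
    (f := fun p => h (p.1, p.2.2)) (by fun_prop) (by fun_prop) (by fun_prop)
  have j₂ := condDistrib_comp_prodMk (μ := μ) (Z := Z) (U := fun ω => (X ω, Y ω))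
    (f := fun p => p.2.1) (by fun_prop) (by fun_prop) (by fun_prop)
  have j₃ := condDistrib_comp_prodMk (μ := μ) (Z := Z) (U := fun ω => (X ω, Y ω))
    (f := fun p => p.2.2) (by fun_prop) (by fun_prop) (by fun_prop)
  -- For fixed `c`, the map `(x, y) ↦ (x, h (c, y))` sends both the joint law and the product of its
  -- marginals to those of the processed pair, so relative entropy decreases.
  calc _ ≤ ∫⁻ c, klDiv (η c) (((η c).map Prod.fst).prod ((η c).map Prod.snd))
        ∂(μ.map fun ω => φ (Z ω)) := by
        refine lintegral_mono_ae ?_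
        filter_upwards [key, k₁, k₂, k₃] with c h0 h1 h2 h3
        rw [h1, h2, h3, h0]
        have hhc : Measurable fun b => h (c, b) := by fun_prop
        have := klDiv_map_le (μ := η c) (ν := ((η c).map Prod.fst).prod ((η c).map Prod.snd))
          (g := fun p : α × β => (p.1, h (c, p.2))) (by fun_prop)
        refine le_trans (le_of_eq ?_) this
        congr 1
        have := Measure.map_prod_map ((η c).map Prod.fst) ((η c).map Prod.snd)
          (f := id) measurable_id hhc
        rw [Measure.map_id, Measure.map_map hhc measurable_snd] at this
        exact this
    _ = ∫⁻ c, klDiv (η c) (((η c).map Prod.fst).prod ((η c).map Prod.snd))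
        ∂((μ.map Z).map φ) := by rw [Measure.map_map hφ hZ]; rfl
    -- The inequality form of the change of variables spares the measurability of `klDiv` in the
    -- parameter.
    _ ≤ ∫⁻ c, klDiv (η (φ c)) (((η (φ c)).map Prod.fst).prod ((η (φ c)).map Prod.snd))
        ∂(μ.map Z) := lintegral_map_le _ _
    _ = _ := by
        refine lintegral_congr_ae ?_
        filter_upwards [hη, j₂, j₃] with c h0 h2 h3
        rw [h2, h3, h0]

theorem condDistrib_map_measure [IsFiniteMeasure μ] [StandardBorelSpace α] [Nonempty α]
    {Ω' : Type*} [MeasurableSpace Ω'] {Φ : Ω → Ω'} (hΦ : Measurable Φ) {W : Ω' → α} {Z : Ω' → κ}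
    (hW : Measurable W) (hZ : Measurable Z) :
    condDistrib W Z (μ.map Φ) = condDistrib (fun ω => W (Φ ω)) (fun ω => Z (Φ ω)) μ := by
  rw [condDistrib, condDistrib]
  congr 1
  rw [Measure.map_map (by fun_prop) hΦ]
  rfl

/-- Transports costs between the sample space of a sensor and that of a kernel. -/
theorem condMutualInfo_map [IsFiniteMeasure μ] [StandardBorelSpace α] [Nonempty α]
    [StandardBorelSpace β] [Nonempty β] {Ω' : Type*} [MeasurableSpace Ω'] {Φ : Ω → Ω'}
    (hΦ : Measurable Φ) {X : Ω' → α} {Y : Ω' → β} {Z : Ω' → κ} (hX : Measurable X)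
    (hY : Measurable Y) (hZ : Measurable Z) :
    condMutualInfo (μ.map Φ) X Y Z
      = condMutualInfo μ (fun ω => X (Φ ω)) (fun ω => Y (Φ ω)) (fun ω => Z (Φ ω)) := by
  unfold condMutualInfo
  rw [condDistrib_map_measure hΦ (by fun_prop) hZ, condDistrib_map_measure hΦ hX hZ,
    condDistrib_map_measure hΦ hY hZ, Measure.map_map hZ hΦ]
  rfl

end Generic

-- Gaussian vectors and their covariance matrices.

section Gaussian

open scoped RealInnerProductSpace

@[fun_prop]
theorem continuous_toEuclideanLin {m n : ℕ} (A : Matrix (Fin m) (Fin n) ℝ) :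
    Continuous (Matrix.toEuclideanLin A) :=
  LinearMap.continuous_of_finiteDimensional _

@[fun_prop]
theorem measurable_toEuclideanLin {m n : ℕ} (A : Matrix (Fin m) (Fin n) ℝ) :
    Measurable (Matrix.toEuclideanLin A) :=
  (continuous_toEuclideanLin A).measurable

theorem ofLp_toEuclideanLin {m n : ℕ} (A : Matrix (Fin m) (Fin n) ℝ) (v : Vec n) :
    (Matrix.toEuclideanLin A v).ofLp = A *ᵥ v.ofLp := rfl

theorem inner_eq_dotProduct {n : ℕ} (v w : Vec n) : ⟪v, w⟫ = v.ofLp ⬝ᵥ w.ofLp := by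
  rw [EuclideanSpace.inner_eq_star_dotProduct, dotProduct_comm]; simp

theorem inner_toEuclideanLin {m n : ℕ} (A : Matrix (Fin m) (Fin n) ℝ) (v : Vec m) (w : Vec n) :
    ⟪v, Matrix.toEuclideanLin A w⟫ = ⟪Matrix.toEuclideanLin Aᵀ v, w⟫ := by
  rw [inner_eq_dotProduct, inner_eq_dotProduct, ofLp_toEuclideanLin, ofLp_toEuclideanLin,
    dotProduct_mulVec, mulVec_transpose]

theorem toEuclideanLin_mul_apply {l m n : ℕ} (A : Matrix (Fin l) (Fin m) ℝ)
    (B : Matrix (Fin m) (Fin n) ℝ) (v : Vec n) :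
    Matrix.toEuclideanLin (A * B) v = Matrix.toEuclideanLin A (Matrix.toEuclideanLin B v) := by
  ext i
  simp

theorem posSemidef_mul_mul_transpose {m n : ℕ} (A : Matrix (Fin m) (Fin n) ℝ)
    {P : Matrix (Fin n) (Fin n) ℝ} (hP : P.PosSemidef) : (A * P * Aᵀ).PosSemidef := by
  simpa [conjTranspose_eq_transpose_of_trivial] using hP.mul_mul_conjTranspose_same A

theorem multivariateGaussian_zero_zero (n : ℕ) :
    multivariateGaussian (0 : Vec n) (0 : Matrix (Fin n) (Fin n) ℝ) = Measure.dirac 0 := by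
  simp [multivariateGaussian]

theorem map_toEuclideanLin_multivariateGaussian {m n : ℕ} (A : Matrix (Fin m) (Fin n) ℝ)
    {P : Matrix (Fin n) (Fin n) ℝ} (hP : P.PosSemidef) :
    (multivariateGaussian (0 : Vec n) P).map (Matrix.toEuclideanLin A)
      = multivariateGaussian 0 (A * P * Aᵀ) := by
  have := Measure.isProbabilityMeasure_map (μ := multivariateGaussian (0 : Vec n) P)
    (measurable_toEuclideanLin A).aemeasurable
  refine Measure.ext_of_charFun (funext fun t => ?_)
  have e : charFun ((multivariateGaussian (0 : Vec n) P).map (Matrix.toEuclideanLin A)) t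
      = charFun (multivariateGaussian (0 : Vec n) P) (Matrix.toEuclideanLin Aᵀ t) := by
    rw [charFun_apply, charFun_apply, integral_map (by fun_prop) (by fun_prop)]
    have : ∀ x : Vec n, ⟪Matrix.toEuclideanLin A x, t⟫ = ⟪x, Matrix.toEuclideanLin Aᵀ t⟫ :=
      fun x => by rw [real_inner_comm, inner_toEuclideanLin, real_inner_comm]
    simp_rw [this]
  rw [e, charFun_multivariateGaussian hP,
    charFun_multivariateGaussian (posSemidef_mul_mul_transpose A hP), inner_zero_right,
    inner_zero_right, ofLp_toEuclideanLin, ← mulVec_mulVec, ← mulVec_mulVec,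
    dotProduct_mulVec t.ofLp A, mulVec_transpose A t.ofLp]

variable {Ω : Type*} [MeasurableSpace Ω] {μ : Measure Ω}

theorem memLp_inner_of_map_eq {n : ℕ} {P : Matrix (Fin n) (Fin n) ℝ} {e : Ω → Vec n}
    (he : Measurable e) (hP : μ.map e = multivariateGaussian 0 P) (a : Vec n) :
    MemLp (fun ω => ⟪a, e ω⟫) 2 μ := by
  have h : MemLp id 2 (multivariateGaussian (0 : Vec n) P) := IsGaussian.memLp_two_id
  rw [← hP, memLp_map_measure_iff (by fun_prop) (by fun_prop)] at h
  exact h.const_inner a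

theorem covariance_inner_of_map_eq {n : ℕ} {P : Matrix (Fin n) (Fin n) ℝ} (hP : P.PosSemidef)
    {e : Ω → Vec n} (he : Measurable e) (heP : μ.map e = multivariateGaussian 0 P) (a c : Vec n) :
    cov[fun ω => ⟪a, e ω⟫, fun ω => ⟪c, e ω⟫; μ] = a.ofLp ⬝ᵥ P *ᵥ c.ofLp := by
  rw [← covarianceBilin_multivariateGaussian (μ := 0) hP,
    covarianceBilin_apply_eq_cov IsGaussian.memLp_two_id, ← heP, covariance_map]
  · rfl
  all_goals fun_prop

variable [IsProbabilityMeasure μ]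

theorem map_add_multivariateGaussian {m n r : ℕ} (A : Matrix (Fin m) (Fin n) ℝ)
    (B : Matrix (Fin m) (Fin r) ℝ) {P : Matrix (Fin n) (Fin n) ℝ} {Q : Matrix (Fin r) (Fin r) ℝ}
    (hP : P.PosSemidef) (hQ : Q.PosSemidef) {e : Ω → Vec n} {w : Ω → Vec r} (he : Measurable e)
    (hw : Measurable w) (hePe : μ.map e = multivariateGaussian 0 P)
    (hwQ : μ.map w = multivariateGaussian 0 Q) (hew : IndepFun e w μ) :
    μ.map (fun ω => Matrix.toEuclideanLin A (e ω) + Matrix.toEuclideanLin B (w ω))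
      = multivariateGaussian 0 (A * P * Aᵀ + B * Q * Bᵀ) := by
  have := Measure.isProbabilityMeasure_map (μ := μ)
    (f := fun ω => Matrix.toEuclideanLin A (e ω) + Matrix.toEuclideanLin B (w ω)) (by fun_prop)
  have hi : IndepFun (fun ω => Matrix.toEuclideanLin A (e ω))
    (fun ω => Matrix.toEuclideanLin B (w ω)) μ :=
    hew.comp (measurable_toEuclideanLin A) (measurable_toEuclideanLin B)
  have e₁ : μ.map (fun ω => Matrix.toEuclideanLin A (e ω))
      = multivariateGaussian 0 (A * P * Aᵀ) := by
    rw [← map_toEuclideanLin_multivariateGaussian A hP, ← hePe,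
      Measure.map_map (by fun_prop) he]; rfl
  have e₂ : μ.map (fun ω => Matrix.toEuclideanLin B (w ω))
      = multivariateGaussian 0 (B * Q * Bᵀ) := by
    rw [← map_toEuclideanLin_multivariateGaussian B hQ, ← hwQ,
      Measure.map_map (by fun_prop) hw]; rfl
  refine Measure.ext_of_charFun ?_
  rw [hi.charFun_map_fun_add_eq_mul (by fun_prop) (by fun_prop), e₁, e₂]
  ext t
  have hP' := posSemidef_mul_mul_transpose A hP
  have hQ' := posSemidef_mul_mul_transpose B hQ
  rw [Pi.mul_apply, charFun_multivariateGaussian hP', charFun_multivariateGaussian hQ',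
    charFun_multivariateGaussian (hP'.add hQ'), ← Complex.exp_add, add_mulVec, dotProduct_add]
  congr 1
  push_cast
  simp
  ring

/-- The Kalman gain makes the estimation error independent of the innovation. -/
theorem indepFun_error_innovation {n r : ℕ} {P : Matrix (Fin n) (Fin n) ℝ}
    {V : Matrix (Fin r) (Fin r) ℝ} (hP : P.PosSemidef) (hV : V.PosDef)
    (C : Matrix (Fin r) (Fin n) ℝ) {K : Matrix (Fin n) (Fin r) ℝ}
    (hK : K * (C * P * Cᵀ + V) = P * Cᵀ) {e : Ω → Vec n} {v : Ω → Vec r} (he : Measurable e)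
    (hv : Measurable v) (heP : μ.map e = multivariateGaussian 0 P)
    (hvV : μ.map v = multivariateGaussian 0 V) (hev : IndepFun e v μ) :
    IndepFun (fun ω => e ω - Matrix.toEuclideanLin K (Matrix.toEuclideanLin C (e ω) + v ω))
      (fun ω => Matrix.toEuclideanLin C (e ω) + v ω) μ := by
  have ge : HasGaussianLaw e μ := ⟨by rw [heP]; infer_instance⟩
  have gv : HasGaussianLaw v μ := ⟨by rw [hvV]; infer_instance⟩
  have g := hev.hasGaussianLaw ge gv
  let CL := (Matrix.toEuclideanLin C).toContinuousLinearMap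
  let KL := (Matrix.toEuclideanLin K).toContinuousLinearMap
  let N := CL.comp (ContinuousLinearMap.fst ℝ (Vec n) (Vec r))
    + ContinuousLinearMap.snd ℝ (Vec n) (Vec r)
  have g' := g.map_fun ((ContinuousLinearMap.fst ℝ (Vec n) (Vec r) - KL.comp N).prod N)
  -- Error and innovation are jointly Gaussian, as a linear image of `(e, v)`, so vanishing
  -- covariances suffice.
  refine HasGaussianLaw.indepFun_of_covariance_inner (by exact g') fun x y => ?_
  have h₁ : (fun ω => ⟪x, e ω - Matrix.toEuclideanLin K (Matrix.toEuclideanLin C (e ω) + v ω)⟫)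
      = (fun ω => ⟪Matrix.toEuclideanLin (1 - K * C)ᵀ x, e ω⟫)
        + (fun ω => ⟪Matrix.toEuclideanLin (-K)ᵀ x, v ω⟫) := by
    ext ω
    rw [Pi.add_apply, ← inner_toEuclideanLin, ← inner_toEuclideanLin, ← inner_add_right]
    congr 1
    simp only [map_sub, map_neg, map_add, LinearMap.sub_apply, LinearMap.neg_apply,
      toEuclideanLin_mul_apply]
    have : Matrix.toEuclideanLin (1 : Matrix (Fin n) (Fin n) ℝ) (e ω) = e ω := by
      ext i; simp
    rw [this]
    abel
  have h₂ : (fun ω => ⟪y, Matrix.toEuclideanLin C (e ω) + v ω⟫)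
      = (fun ω => ⟪Matrix.toEuclideanLin Cᵀ y, e ω⟫) + (fun ω => ⟪y, v ω⟫) := by
    ext ω
    rw [Pi.add_apply, inner_add_right, inner_toEuclideanLin]
  have me := memLp_inner_of_map_eq he heP
  have mv := memLp_inner_of_map_eq hv hvV
  have ie : ∀ a b, cov[fun ω => ⟪a, e ω⟫, fun ω => ⟪b, v ω⟫; μ] = 0 := fun a b =>
    (hev.comp (φ := fun z => ⟪a, z⟫) (ψ := fun z => ⟪b, z⟫) (by fun_prop)
      (by fun_prop)).covariance_eq_zero (me a) (mv b)
  rw [h₁, h₂, covariance_add_left (me _) (mv _) ((me _).add (mv _)),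
    covariance_add_right (me _) (me _) (mv _), covariance_add_right (mv _) (me _) (mv _), ie,
    covariance_comm (fun ω => ⟪Matrix.toEuclideanLin (-K)ᵀ x, v ω⟫), ie,
    covariance_inner_of_map_eq hP he heP, covariance_inner_of_map_eq hV.posSemidef hv hvV]
  simp only [ofLp_toEuclideanLin, mulVec_transpose, add_zero, zero_add, ← dotProduct_mulVec]
  rw [← mulVec_transpose C, ← dotProduct_add, mulVec_mulVec, mulVec_mulVec, mulVec_mulVec,
    ← add_mulVec]
  -- The cross-covariance of error and innovation; it vanishes exactly by the normal equation `hK`.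
  have : (1 - K * C) * P * Cᵀ + -K * V = 0 := by
    calc (1 - K * C) * P * Cᵀ + -K * V = P * Cᵀ - K * (C * P * Cᵀ + V) := by
          simp only [Matrix.sub_mul, Matrix.one_mul, Matrix.neg_mul, Matrix.mul_add,
            Matrix.mul_assoc]
          abel
      _ = 0 := by rw [hK, sub_self]
  rw [this]
  simp

/-- A nonzero linear functional of a nondegenerate Gaussian vector has no atoms. -/
theorem multivariateGaussian_hyperplane {n : ℕ} {W : Matrix (Fin n) (Fin n) ℝ} (hW : W.PosDef)
    {b : Vec n} (hb : b ≠ 0) (s : ℝ) :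
    multivariateGaussian (0 : Vec n) W {x | ⟪b, x⟫ = s} = 0 := by
  have h := IsGaussian.map_eq_gaussianReal (μ := multivariateGaussian (0 : Vec n) W)
    (innerSL ℝ b)
  have hv : 0 < Var[innerSL ℝ b; multivariateGaussian (0 : Vec n) W] := by
    have := covarianceBilin_self (μ := multivariateGaussian (0 : Vec n) W)
      IsGaussian.memLp_two_id b
    rw [covarianceBilin_multivariateGaussian hW.posSemidef] at this
    have e : (⇑(innerSL ℝ b) : Vec n → ℝ) = fun u => ⟪b, u⟫ := by ext; simp
    rw [e, ← this]
    have h2 := hW.dotProduct_mulVec_pos (x := b.ofLp) (by simpa using hb)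
    simpa using h2
  have e : {x : Vec n | ⟪b, x⟫ = s} = (innerSL ℝ b) ⁻¹' {s} := by ext; simp
  rw [e, ← Measure.map_apply (by fun_prop) (measurableSet_singleton s), h]
  have := nullSingletonClass_gaussianReal (μ := (multivariateGaussian (0 : Vec n) W)[innerSL ℝ b])
    (v := Var[innerSL ℝ b; multivariateGaussian (0 : Vec n) W].toNNReal)
    (by simpa using hv)
  exact measure_singleton s

/-- The image has covariance `M G Mᵀ = 0`, hence is a point mass: singular noise almost surely has
no component in a direction that annihilates `G`. -/
theorem multivariateGaussian_ae_eq_zero {m n : ℕ} {G : Matrix (Fin n) (Fin n) ℝ}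
    (hG : G.PosSemidef) {M : Matrix (Fin m) (Fin n) ℝ} (h : M * G = 0) :
    ∀ᵐ x ∂(multivariateGaussian (0 : Vec n) G), Matrix.toEuclideanLin M x = 0 := by
  have e := map_toEuclideanLin_multivariateGaussian M hG
  rw [h, Matrix.zero_mul, multivariateGaussian_zero_zero] at e
  have : ∀ᵐ y ∂((multivariateGaussian (0 : Vec n) G).map (Matrix.toEuclideanLin M)), y = 0 := by
    rw [e]
    exact (ae_dirac_iff (p := fun y : Vec m => y = 0) (measurableSet_singleton 0)).2 rfl
  exact ae_of_ae_map (by fun_prop) this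

@[fun_prop]
theorem measurable_weightedSq {n : ℕ} (Θ : Matrix (Fin n) (Fin n) ℝ) :
    Measurable (weightedSq Θ) := by
  have : (weightedSq Θ) = fun v : Vec n => ⟪v, Matrix.toEuclideanLin Θ v⟫ := by
    ext v
    rw [inner_eq_dotProduct]; rfl
  rw [this]
  fun_prop

theorem weightedSq_nonneg {n : ℕ} {Θ : Matrix (Fin n) (Fin n) ℝ} (hΘ : Θ.PosSemidef) (v : Vec n) :
    0 ≤ weightedSq Θ v := by
  simpa [weightedSq] using hΘ.dotProduct_mulVec_nonneg v.ofLp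

/-- Shifting a centred Gaussian vector by an independent vector does not decrease its weighted
second moment. -/
theorem lintegral_weightedSq_le_add {n : ℕ} {Θ P : Matrix (Fin n) (Fin n) ℝ} (hΘ : Θ.PosSemidef)
    (hP : P.PosSemidef) {e H : Ω → Vec n} (he : Measurable e) (hH : Measurable H)
    (heP : μ.map e = multivariateGaussian 0 P) (heH : IndepFun e H μ) :
    ∫⁻ ω, ENNReal.ofReal (weightedSq Θ (e ω)) ∂μ
      ≤ ∫⁻ ω, ENNReal.ofReal (weightedSq Θ (e ω + H ω)) ∂μ := by
  have hneg : (multivariateGaussian (0 : Vec n) P).map (fun x => -x)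
      = multivariateGaussian 0 P := by
    have := map_toEuclideanLin_multivariateGaussian (-1 : Matrix (Fin n) (Fin n) ℝ) hP
    have e : ⇑(Matrix.toEuclideanLin (-1 : Matrix (Fin n) (Fin n) ℝ)) = fun x => -x := by
      ext x i
      simp
    rw [e] at this
    simpa using this
  -- For a deterministic shift, `x` and `-x` have the same law, so the parallelogram identity for `x
  -- + h` and `-x + h` gives the bound without any integrability.
  have key : ∀ h : Vec n, ∫⁻ x, ENNReal.ofReal (weightedSq Θ x) ∂(multivariateGaussian (0 : Vec n) P)
      ≤ ∫⁻ x, ENNReal.ofReal (weightedSq Θ (x + h)) ∂(multivariateGaussian (0 : Vec n) P) := by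
    intro h
    have e₁ : ∫⁻ x, ENNReal.ofReal (weightedSq Θ (x + h)) ∂(multivariateGaussian (0 : Vec n) P)
        = ∫⁻ x, ENNReal.ofReal (weightedSq Θ (-x + h)) ∂(multivariateGaussian (0 : Vec n) P) := by
      conv_lhs => rw [← hneg]
      rw [lintegral_map (by fun_prop) (by fun_prop)]
    have e₂ : 2 * ∫⁻ x, ENNReal.ofReal (weightedSq Θ x) ∂(multivariateGaussian (0 : Vec n) P)
        ≤ 2 * ∫⁻ x, ENNReal.ofReal (weightedSq Θ (x + h))
          ∂(multivariateGaussian (0 : Vec n) P) := by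
      conv_rhs => rw [two_mul]
      conv_rhs => rhs; rw [e₁]
      rw [← lintegral_add_left (by fun_prop), ← lintegral_const_mul _ (by fun_prop)]
      refine lintegral_mono fun x => ?_
      rw [← ENNReal.ofReal_add (weightedSq_nonneg hΘ _) (weightedSq_nonneg hΘ _), two_mul,
        ← ENNReal.ofReal_add (weightedSq_nonneg hΘ _) (weightedSq_nonneg hΘ _)]
      refine ENNReal.ofReal_le_ofReal ?_
      have h0 := weightedSq_nonneg hΘ h
      have e : weightedSq Θ (x + h) + weightedSq Θ (-x + h)
          = 2 * weightedSq Θ x + 2 * weightedSq Θ h := by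
        simp only [weightedSq, WithLp.ofLp_add, WithLp.ofLp_neg, mulVec_add, mulVec_neg,
          add_dotProduct, dotProduct_add, neg_dotProduct, dotProduct_neg]
        ring
      linarith
    exact (ENNReal.mul_le_mul_iff_right (by simp) (by simp)).1 e₂
  have hj := (indepFun_iff_map_prod_eq_prod_map_map he.aemeasurable hH.aemeasurable).1 heH
  have := Measure.isProbabilityMeasure_map (μ := μ) hH.aemeasurable
  have r : ∫⁻ ω, ENNReal.ofReal (weightedSq Θ (e ω + H ω)) ∂μ
      = ∫⁻ h, ∫⁻ x, ENNReal.ofReal (weightedSq Θ (x + h)) ∂(multivariateGaussian (0 : Vec n) P)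
        ∂(μ.map H) := by
    rw [← heP, ← lintegral_prod_symm (μ := μ.map e) (ν := μ.map H)
      (fun p => ENNReal.ofReal (weightedSq Θ (p.1 + p.2))) (by fun_prop), ← hj,
      lintegral_map (by fun_prop) (by fun_prop)]
  have l : ∫⁻ ω, ENNReal.ofReal (weightedSq Θ (e ω)) ∂μ
      = ∫⁻ x, ENNReal.ofReal (weightedSq Θ x) ∂(multivariateGaussian (0 : Vec n) P) := by
    rw [← heP, lintegral_map (by fun_prop) he]
  rw [l, r]
  calc _ = ∫⁻ _, ∫⁻ x, ENNReal.ofReal (weightedSq Θ x) ∂(multivariateGaussian (0 : Vec n) P)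
        ∂(μ.map H) := by simp
    _ ≤ _ := lintegral_mono fun h => key h

/-- A compression of a positive semidefinite matrix to its range. -/
theorem exists_posDef_compression {n : ℕ} {G : Matrix (Fin n) (Fin n) ℝ} (hG : G.PosSemidef) :
    ∃ (r : ℕ) (U : Matrix (Fin n) (Fin r) ℝ), (Uᵀ * G * U).PosDef ∧ (1 - U * Uᵀ) * G = 0 := by
  set lam := hG.isHermitian.eigenvalues with hlam
  set Q : Matrix (Fin n) (Fin n) ℝ := (hG.isHermitian.eigenvectorUnitary).1 with hQ
  have hQ₁ : Qᵀ * Q = 1 := by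
    simpa [star_eq_conjTranspose, conjTranspose_eq_transpose_of_trivial] using
      Unitary.coe_star_mul_self hG.isHermitian.eigenvectorUnitary
  have hQ₂ : G = Q * diagonal lam * Qᵀ := by
    have := hG.isHermitian.spectral_theorem
    rw [Unitary.conjStarAlgAut_apply] at this
    simpa [star_eq_conjTranspose, conjTranspose_eq_transpose_of_trivial, Function.comp_def] using this
  let f := (Fintype.equivFin {i // lam i ≠ 0}).symm
  have hQ₃ : Qᵀ * G * Q = diagonal lam := by
    calc Qᵀ * G * Q = (Qᵀ * Q) * diagonal lam * (Qᵀ * Q) := by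
          conv_lhs => rw [hQ₂]
          simp only [Matrix.mul_assoc]
      _ = _ := by rw [hQ₁]; simp
  -- The columns are the orthonormal eigenvectors with nonzero eigenvalue.
  refine ⟨_, Q.submatrix id fun j => (f j).1, ?_, ?_⟩
  · have : (Q.submatrix id fun j => (f j).1)ᵀ * G * (Q.submatrix id fun j => (f j).1)
        = diagonal fun j => lam (f j).1 := by
      have e : (Q.submatrix id fun j => (f j).1)ᵀ * G * (Q.submatrix id fun j => (f j).1)
          = (Qᵀ * G * Q).submatrix (fun j => (f j).1) (fun j => (f j).1) := by
        ext i j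
        simp [Matrix.mul_apply]
      rw [e, hQ₃]
      ext i j
      by_cases hij : i = j
      · simp [hij]
      · have : (f i).1 ≠ (f j).1 := fun h => hij (f.injective (Subtype.ext h))
        simp [hij, this]
    rw [this, posDef_diagonal_iff]
    intro j
    exact lt_of_le_of_ne (hG.eigenvalues_nonneg _) (Ne.symm (f j).2)
  -- `U Uᵀ` is the spectral projection onto the nonzero eigenvalues, so it fixes `G`.
  · have : (Q.submatrix id fun j => (f j).1) * (Q.submatrix id fun j => (f j).1)ᵀ
        = Q * diagonal (fun i => if lam i = 0 then 0 else 1) * Qᵀ := by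
      ext i k
      rw [Matrix.mul_apply, Matrix.mul_apply]
      simp only [mul_diagonal, transpose_apply, submatrix_apply, id]
      rw [Equiv.sum_comp f (fun j => Q i j.1 * Q k j.1),
        ← Finset.sum_subtype (Finset.univ.filter fun j => lam j ≠ 0) (by simp)
          (fun j => Q i j * Q k j), Finset.sum_filter]
      refine Finset.sum_congr rfl fun j _ => ?_
      by_cases h : lam j = 0 <;> simp [h]
    rw [this, Matrix.sub_mul, Matrix.one_mul, sub_eq_zero]
    conv_rhs => rw [hQ₂]
    calc G = Q * (diagonal (fun i => if lam i = 0 then 0 else 1) * (1 * diagonal lam)) * Qᵀ := by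
          rw [hQ₂, Matrix.one_mul, diagonal_mul_diagonal]
          congr 3
          ext i
          by_cases h : lam i = 0 <;> simp [h]
      _ = _ := by rw [← hQ₁]; simp only [Matrix.mul_assoc]

end Gaussian

-- Independence structure of the inputs.

section Noise

/-- The hypotheses make `a`, `b`, `c` mutually independent, so they may be regrouped. The Kalman
induction uses this to move fresh noise and innovations across an independence relation. -/
theorem indepFun_prodMk_right_comm {Ω α β κ : Type*} [MeasurableSpace Ω] [MeasurableSpace α]
    [MeasurableSpace β] [MeasurableSpace κ] {μ : Measure Ω} [IsProbabilityMeasure μ] {a : Ω → α}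
    {b : Ω → β} {c : Ω → κ} (ha : Measurable a) (hb : Measurable b) (hc : Measurable c)
    (habc : IndepFun (fun ω => (a ω, b ω)) c μ) (hab : IndepFun a b μ) :
    IndepFun (fun ω => (a ω, c ω)) b μ := by
  have hac : IndepFun a c μ := habc.comp (φ := Prod.fst) (ψ := id) measurable_fst measurable_id
  rw [indepFun_iff_map_prod_eq_prod_map_map (by fun_prop) (by fun_prop)] at habc hab hac ⊢
  have := Measure.isProbabilityMeasure_map (μ := μ) ha.aemeasurable
  have := Measure.isProbabilityMeasure_map (μ := μ) hb.aemeasurable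
  have := Measure.isProbabilityMeasure_map (μ := μ) hc.aemeasurable
  have e : μ.map (fun ω => ((a ω, c ω), b ω))
      = (μ.map (fun ω => ((a ω, b ω), c ω))).map (fun p => ((p.1.1, p.2), p.1.2)) := by
    rw [Measure.map_map (by fun_prop) (by fun_prop)]; rfl
  rw [e, habc, hab, hac]
  refine Measure.ext_of_lintegral _ fun F hF => ?_
  rw [lintegral_map hF (by fun_prop), lintegral_prod _ (by fun_prop),
    lintegral_prod _ (by fun_prop), lintegral_prod _ (by fun_prop), lintegral_prod _ (by fun_prop)]
  refine lintegral_congr fun x => ?_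
  rw [lintegral_lintegral_swap (Measurable.aemeasurable (by fun_prop))]

/-- Extension of a finite family of vectors by zero. -/
noncomputable def extendZero {d : ℕ → ℕ} (I : Finset ℕ) (h : (s : I) → Vec (d s)) (s : ℕ) :
    Vec (d s) :=
  if hs : s ∈ I then h ⟨s, hs⟩ else 0

@[fun_prop]
theorem measurable_extendZero {d : ℕ → ℕ} (I : Finset ℕ) :
    Measurable (extendZero (d := d) I) := by
  refine measurable_pi_lambda _ fun s => ?_
  unfold extendZero
  split_ifs <;> fun_prop

theorem extendZero_history {Ω : Type*} {d : ℕ → ℕ} (Y : (t : ℕ) → Ω → Vec (d t)) {I : Finset ℕ}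
    {s : ℕ} (hs : s ∈ I) (ω : Ω) : extendZero I (history Y I ω) s = Y s ω := by
  simp [extendZero, hs, history]

theorem measurable_history {Ω : Type*} [MeasurableSpace Ω] {d : ℕ → ℕ}
    {Y : (t : ℕ) → Ω → Vec (d t)} {I : Finset ℕ} (hY : ∀ t ∈ I, Measurable (Y t)) :
    Measurable (history Y I) :=
  measurable_pi_lambda _ fun s => hY s.1 s.2

variable {T : ℕ} {n : ℕ → ℕ} (S : Source T n) {d : ℕ → ℕ}
  (N : (t : ℕ) → Matrix (Fin (d t)) (Fin (d t)) ℝ)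

theorem map_input (t : ℕ) : (noiseMeasure S N).map (fun ω => ω.1 t)
    = multivariateGaussian 0 (S.inputCov t) := by
  have : (fun ω : Sample n d => ω.1 t) = (fun x => x t) ∘ Prod.fst := rfl
  rw [this, ← Measure.map_map (by fun_prop) (by fun_prop), noiseMeasure, Measure.map_fst_prod]
  simp [Measure.infinitePi_map_eval]

theorem map_noise (t : ℕ) : (noiseMeasure S N).map (fun ω => ω.2 t)
    = multivariateGaussian 0 (N t) := by
  have : (fun ω : Sample n d => ω.2 t) = (fun x => x t) ∘ Prod.snd := rfl
  rw [this, ← Measure.map_map (by fun_prop) (by fun_prop), noiseMeasure, Measure.map_snd_prod]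
  simp [Measure.infinitePi_map_eval]

theorem indepFun_input_noise (t : ℕ) :
    IndepFun (fun ω => ω.1 t) (fun ω => ω.2 t) (noiseMeasure S N) :=
  indepFun_prod (X := fun x : (t : ℕ) → Vec (n t) => x t) (Y := fun x : (t : ℕ) → Vec (d t) => x t)
    (by fun_prop) (by fun_prop)

theorem indepFun_restrict_eval {k : ℕ → ℕ} (ν : (t : ℕ) → Measure (Vec (k t)))
    [∀ t, IsProbabilityMeasure (ν t)] (t : ℕ) :
    IndepFun (fun x (s : Finset.range (t + 1)) => x s.1) (fun x => x (t + 1))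
      (Measure.infinitePi ν) := by
  have h : iIndepFun (fun i (x : (t : ℕ) → Vec (k t)) => x i) (Measure.infinitePi ν) :=
    iIndepFun_infinitePi (X := fun i x => x) (fun i => measurable_id)
  have := h.indepFun_finset (Finset.range (t + 1)) {t + 1} (by simp) (fun i => by fun_prop)
  have hψ : Measurable fun z : (i : ({t + 1} : Finset ℕ)) → Vec (k i) =>
      z ⟨t + 1, Finset.mem_singleton_self _⟩ :=
    measurable_pi_apply (⟨t + 1, Finset.mem_singleton_self _⟩ : ({t + 1} : Finset ℕ))
  exact this.comp measurable_id hψ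

/-- Whatever depends only on the inputs up to time `t` is independent of the inputs at time
`t + 1`. -/
theorem indepFun_next {α : Type*} [MeasurableSpace α] {f : Sample n d → α} (hf : Measurable f)
    (t : ℕ) (hdep : ∀ ω ω' : Sample n d,
      (∀ s ≤ t, ω.1 s = ω'.1 s) → (∀ s ≤ t, ω.2 s = ω'.2 s) → f ω = f ω') :
    IndepFun f (fun ω => (ω.1 (t + 1), ω.2 (t + 1))) (noiseMeasure S N) := by
  have h := indepFun_prod_prodMk (by fun_prop) (by fun_prop) (by fun_prop) (by fun_prop)
    (indepFun_restrict_eval (fun t => multivariateGaussian (0 : Vec (n t)) (S.inputCov t)) t)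
    (indepFun_restrict_eval (fun t => multivariateGaussian (0 : Vec (d t)) (N t)) t)
  -- Replacing the inputs after time `t` by zero leaves `f` unchanged, by `hdep`, and exhibits it as
  -- a function of the restricted inputs.
  have h' := h.comp (φ := fun p => f (extendZero _ p.1, extendZero _ p.2)) (ψ := id)
    (by fun_prop) measurable_id
  convert! h' using 1
  ext ω
  refine hdep _ _ (fun s hs => ?_) (fun s hs => ?_) <;>
    simp [extendZero, Nat.lt_succ_of_le hs]

@[fun_prop]
theorem measurable_state (t : ℕ) : Measurable (S.x (d := d) t) := by
  induction t with
  | zero => exact (measurable_pi_apply 0).comp measurable_fst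
  | succ t ih =>
    have : S.x (d := d) (t + 1)
      = fun ω => Matrix.toEuclideanLin (S.A t) (S.x t ω) + ω.1 (t + 1) := rfl
    rw [this]
    fun_prop

theorem integrable_input (t : ℕ) : Integrable (fun ω => ω.1 t) (noiseMeasure S N) := by
  have : Integrable id ((noiseMeasure S N).map (fun ω => ω.1 t)) := by
    rw [map_input]; exact IsGaussian.integrable_id
  exact (integrable_map_measure aestronglyMeasurable_id (by fun_prop)).1 this

theorem integrable_state (t : ℕ) : Integrable (S.x t) (noiseMeasure S N) := by
  induction t with
  | zero => exact integrable_input S N 0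
  | succ t ih =>
    exact ((Matrix.toEuclideanLin (S.A t)).toContinuousLinearMap.integrable_comp ih).add
      (integrable_input S N (t + 1))

/-- The noise dimensions `d` and `d'` may differ, so that states can be compared across the sample
spaces of a sensor and a kernel. -/
theorem state_congr {d' : ℕ → ℕ} {ω : Sample n d} {ω' : Sample n d'} {t : ℕ}
    (h : ∀ s ≤ t, ω.1 s = ω'.1 s) : S.x t ω = S.x t ω' := by
  induction t with
  | zero => exact h 0 le_rfl
  | succ t ih =>
    change Matrix.toEuclideanLin (S.A t) (S.x t ω) + ω.1 (t + 1)
      = Matrix.toEuclideanLin (S.A t) (S.x t ω') + ω'.1 (t + 1)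
    rw [ih fun s hs => h s (by omega), h (t + 1) le_rfl]

/-- Linear transformations of the additional noise. -/
theorem map_noiseMeasure {d' : ℕ → ℕ} (N' : (t : ℕ) → Matrix (Fin (d' t)) (Fin (d' t)) ℝ)
    (M : (t : ℕ) → Matrix (Fin (d' t)) (Fin (d t)) ℝ)
    (h : ∀ t, (multivariateGaussian (0 : Vec (d t)) (N t)).map (Matrix.toEuclideanLin (M t))
      = multivariateGaussian 0 (N' t)) :
    (noiseMeasure S N).map (fun ω => (ω.1, fun t => Matrix.toEuclideanLin (M t) (ω.2 t)))
      = noiseMeasure S N' := by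
  unfold noiseMeasure
  have := Measure.map_prod_map
    (Measure.infinitePi fun t => multivariateGaussian (0 : Vec (n t)) (S.inputCov t))
    (Measure.infinitePi fun t => multivariateGaussian (0 : Vec (d t)) (N t))
    (f := id) (g := fun x t => Matrix.toEuclideanLin (M t) (x t)) measurable_id (by fun_prop)
  rw [Measure.map_id, Measure.infinitePi_map_pi _ (fun t => measurable_toEuclideanLin (M t))] at this
  simp_rw [h] at this
  exact this.symm

end Noise

-- The Kalman filter.

namespace Sensor

section Filter

variable {T : ℕ} {n : ℕ → ℕ} (S : Source T n) (σ : Sensor T n)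

@[fun_prop]
theorem measurable_y (t : ℕ) : Measurable (σ.y S t) := by
  unfold y
  fun_prop

/-- The Kalman gain at time `t + 1` for the prediction error covariance `P`. -/
noncomputable def gainOf (t : ℕ) (P : Matrix (Fin (n t)) (Fin (n t)) ℝ) :
    Matrix (Fin (n t)) (Fin (σ.r t)) ℝ :=
  -- Outside the horizon `σ.V t` is an arbitrary matrix; a zero gain removes its noise altogether.
  if t ∈ Finset.Icc 1 T then P * (σ.C t)ᵀ * (σ.C t * P * (σ.C t)ᵀ + σ.V t)⁻¹ else 0

/-- The covariance of the estimation error of the Kalman filter. -/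
noncomputable def errCov : (t : ℕ) → Matrix (Fin (n t)) (Fin (n t)) ℝ
  | 0 => S.P₀
  | t + 1 =>
    let P := S.A t * errCov t * (S.A t)ᵀ + S.W t
    let K := σ.gainOf (t + 1) P
    -- The Joseph form, a sum of two congruences: positive semidefiniteness is visible and no
    -- property of the gain is needed.
    (1 - K * σ.C (t + 1)) * P * (1 - K * σ.C (t + 1))ᵀ + (-K) * σ.V (t + 1) * (-K)ᵀ

/-- The covariance of the one-step prediction error. -/
noncomputable def predCov (t : ℕ) : Matrix (Fin (n (t + 1))) (Fin (n (t + 1))) ℝ :=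
  S.A t * σ.errCov S t * (S.A t)ᵀ + S.W t

/-- The Kalman gain. -/
noncomputable def gain : (t : ℕ) → Matrix (Fin (n t)) (Fin (σ.r t)) ℝ
  | 0 => 0
  | t + 1 => σ.gainOf (t + 1) (σ.predCov S t)

theorem errCov_succ (t : ℕ) : σ.errCov S (t + 1)
    = (1 - σ.gain S (t + 1) * σ.C (t + 1)) * σ.predCov S t
        * (1 - σ.gain S (t + 1) * σ.C (t + 1))ᵀ
      + (-σ.gain S (t + 1)) * σ.V (t + 1) * (-σ.gain S (t + 1))ᵀ := rfl

theorem gain_of_notMem {t : ℕ} (ht : t ∉ Finset.Icc 1 T) : σ.gain S t = 0 := by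
  cases t with
  | zero => rfl
  | succ t => exact if_neg ht

/-- The Kalman filter as a function of the sequence of observations. -/
noncomputable def filter (y : (s : ℕ) → Vec (σ.r s)) : (t : ℕ) → Vec (n t)
  -- There is no observation at time `0`, so the initial estimate is the mean of `x_0`.
  | 0 => 0
  | t + 1 => Matrix.toEuclideanLin (S.A t) (filter y t)
      + Matrix.toEuclideanLin (σ.gain S (t + 1)) (y (t + 1)
        - Matrix.toEuclideanLin (σ.C (t + 1)) (Matrix.toEuclideanLin (S.A t) (filter y t)))

theorem filter_succ (y : (s : ℕ) → Vec (σ.r s)) (t : ℕ) : σ.filter S y (t + 1)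
    = Matrix.toEuclideanLin (S.A t) (σ.filter S y t)
      + Matrix.toEuclideanLin (σ.gain S (t + 1)) (y (t + 1)
        - Matrix.toEuclideanLin (σ.C (t + 1)) (Matrix.toEuclideanLin (S.A t) (σ.filter S y t))) :=
  rfl

theorem filter_congr {y y' : (s : ℕ) → Vec (σ.r s)} {t : ℕ}
    (h : ∀ s ∈ Finset.Icc 1 t, y s = y' s) : σ.filter S y t = σ.filter S y' t := by
  induction t with
  | zero => rfl
  | succ t ih =>
    rw [filter_succ, filter_succ, ih fun s hs => h s (by simp at hs ⊢; omega),
      h (t + 1) (by simp)]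

@[fun_prop]
theorem measurable_filter (t : ℕ) : Measurable fun y => σ.filter S y t := by
  induction t with
  | zero => exact measurable_const
  | succ t ih =>
    simp only [filter_succ]
    fun_prop

/-- The estimate of `x_t` computed by the Kalman filter. -/
noncomputable def estimate (t : ℕ) (ω : Sample n σ.r) : Vec (n t) :=
  σ.filter S (fun s => σ.y S s ω) t

/-- The estimation error of the Kalman filter. -/
noncomputable def error (t : ℕ) (ω : Sample n σ.r) : Vec (n t) := S.x t ω - σ.estimate S t ω

/-- The one-step prediction error. -/
noncomputable def predError (t : ℕ) (ω : Sample n σ.r) : Vec (n (t + 1)) :=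
  Matrix.toEuclideanLin (S.A t) (σ.error S t ω) + ω.1 (t + 1)

@[fun_prop]
theorem measurable_estimate (t : ℕ) : Measurable (σ.estimate S t) := by
  unfold estimate
  fun_prop

@[fun_prop]
theorem measurable_error (t : ℕ) : Measurable (σ.error S t) := by
  unfold error
  fun_prop

@[fun_prop]
theorem measurable_predError (t : ℕ) : Measurable (σ.predError S t) := by
  unfold predError
  fun_prop

theorem estimate_succ (t : ℕ) (ω : Sample n σ.r) : σ.estimate S (t + 1) ω
    = Matrix.toEuclideanLin (S.A t) (σ.estimate S t ω)
      + Matrix.toEuclideanLin (σ.gain S (t + 1)) (σ.y S (t + 1) ω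
        - Matrix.toEuclideanLin (σ.C (t + 1))
            (Matrix.toEuclideanLin (S.A t) (σ.estimate S t ω))) := rfl

theorem state_succ_eq (t : ℕ) (ω : Sample n σ.r) : S.x (t + 1) ω
    = Matrix.toEuclideanLin (S.A t) (σ.estimate S t ω) + σ.predError S t ω := by
  change Matrix.toEuclideanLin (S.A t) (S.x t ω) + ω.1 (t + 1) = _
  rw [predError, error, map_sub]
  abel

theorem y_succ_eq (t : ℕ) (ω : Sample n σ.r) : σ.y S (t + 1) ω
    = Matrix.toEuclideanLin (σ.C (t + 1)) (Matrix.toEuclideanLin (S.A t) (σ.estimate S t ω))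
      + (Matrix.toEuclideanLin (σ.C (t + 1)) (σ.predError S t ω) + ω.2 (t + 1)) := by
  rw [y, state_succ_eq, map_add, add_assoc]

theorem error_succ (t : ℕ) (ω : Sample n σ.r) : σ.error S (t + 1) ω
    = σ.predError S t ω - Matrix.toEuclideanLin (σ.gain S (t + 1))
      (Matrix.toEuclideanLin (σ.C (t + 1)) (σ.predError S t ω) + ω.2 (t + 1)) := by
  rw [error, estimate_succ, y_succ_eq, state_succ_eq, add_sub_cancel_left]
  abel

/-- The error as a combination of two independent Gaussian vectors, which yields its law. -/
theorem error_succ' (t : ℕ) (ω : Sample n σ.r) : σ.error S (t + 1) ω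
    = Matrix.toEuclideanLin (1 - σ.gain S (t + 1) * σ.C (t + 1)) (σ.predError S t ω)
      + Matrix.toEuclideanLin (-σ.gain S (t + 1)) (ω.2 (t + 1)) := by
  have : Matrix.toEuclideanLin (1 : Matrix (Fin (n (t + 1))) (Fin (n (t + 1))) ℝ)
      (σ.predError S t ω) = σ.predError S t ω := by ext i; simp
  rw [error_succ]
  simp only [map_sub, map_neg, map_add, LinearMap.sub_apply, LinearMap.neg_apply,
    toEuclideanLin_mul_apply, this]
  abel

theorem measurable_history_y (I : Finset ℕ) : Measurable (history (σ.y S) I) :=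
  measurable_history fun t _ => σ.measurable_y S t

theorem estimate_eq_filter_extendZero (t : ℕ) (ω : Sample n σ.r) : σ.estimate S t ω
    = σ.filter S (extendZero _ (history (σ.y S) (Finset.Icc 1 t) ω)) t :=
  σ.filter_congr S fun _ hs => (extendZero_history (σ.y S) hs ω).symm

theorem y_congr {ω ω' : Sample n σ.r} {t : ℕ} (h₁ : ∀ s ≤ t, ω.1 s = ω'.1 s)
    (h₂ : ∀ s ≤ t, ω.2 s = ω'.2 s) : σ.y S t ω = σ.y S t ω' := by
  rw [y, y, state_congr S h₁, h₂ t le_rfl]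

theorem indepFun_next_error (t : ℕ) :
    IndepFun (fun ω => (σ.error S t ω, history (σ.y S) (Finset.Icc 1 t) ω))
      (fun ω => (ω.1 (t + 1), ω.2 (t + 1))) (σ.μ S) := by
  have hy : ∀ ω ω' : Sample n σ.r, (∀ s ≤ t, ω.1 s = ω'.1 s) → (∀ s ≤ t, ω.2 s = ω'.2 s) →
      ∀ s ∈ Finset.Icc 1 t, σ.y S s ω = σ.y S s ω' := fun ω ω' h₁ h₂ s hs =>
    σ.y_congr S (fun u hu => h₁ u (hu.trans (Finset.mem_Icc.1 hs).2))
      (fun u hu => h₂ u (hu.trans (Finset.mem_Icc.1 hs).2))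
  have := σ.measurable_history_y S (Finset.Icc 1 t)
  refine indepFun_next S σ.V (by fun_prop) t fun ω ω' h₁ h₂ => ?_
  have e₁ : σ.error S t ω = σ.error S t ω' := by
    rw [error, error, state_congr S h₁, estimate, estimate, σ.filter_congr S (hy ω ω' h₁ h₂)]
  have e₂ : history (σ.y S) (Finset.Icc 1 t) ω = history (σ.y S) (Finset.Icc 1 t) ω' :=
    funext fun s => hy ω ω' h₁ h₂ s.1 s.2
  rw [e₁, e₂]

/-- The law of the Kalman filter error up to time `t`, and its independence of the observations. -/
structure FilterSpec (t : ℕ) : Prop where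
  posSemidef : (σ.errCov S t).PosSemidef
  map_error : (σ.μ S).map (σ.error S t) = multivariateGaussian 0 (σ.errCov S t)
  indepFun : IndepFun (σ.error S t) (history (σ.y S) (Finset.Icc 1 t)) (σ.μ S)

variable {S σ}

theorem FilterSpec.posSemidef_predCov {t : ℕ} (h : σ.FilterSpec S t) (ht : t < T) :
    (σ.predCov S t).PosSemidef :=
  (posSemidef_mul_mul_transpose (S.A t) h.posSemidef).add (S.W_posDef t ht).posSemidef

theorem FilterSpec.map_predError {t : ℕ} (h : σ.FilterSpec S t) (ht : t < T) :
    (σ.μ S).map (σ.predError S t) = multivariateGaussian 0 (σ.predCov S t) := by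
  have hi : IndepFun (σ.error S t) (fun ω => ω.1 (t + 1)) (σ.μ S) :=
    (σ.indepFun_next_error S t).comp (φ := Prod.fst) (ψ := Prod.fst) measurable_fst measurable_fst
  have := map_add_multivariateGaussian (S.A t)
    (1 : Matrix (Fin (n (t + 1))) (Fin (n (t + 1))) ℝ) h.posSemidef
    (S.W_posDef t ht).posSemidef (by fun_prop) (by fun_prop) h.map_error
    (map_input S σ.V (t + 1)) hi
  have e : (fun ω : Sample n σ.r => Matrix.toEuclideanLin (S.A t) (σ.error S t ω)
      + Matrix.toEuclideanLin (1 : Matrix (Fin (n (t + 1))) (Fin (n (t + 1))) ℝ) (ω.1 (t + 1)))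
      = σ.predError S t := by
    ext ω i
    simp [predError]
  rw [e] at this
  simpa [predCov] using this

theorem FilterSpec.indepFun_predError_noise (t : ℕ) :
    IndepFun (σ.predError S t) (fun ω => ω.2 (t + 1)) (σ.μ S) := by
  have h₁ : IndepFun (fun ω => (ω.1 (t + 1), ω.2 (t + 1))) (σ.error S t) (σ.μ S) :=
    ((σ.indepFun_next_error S t).comp (φ := Prod.fst) (ψ := id) measurable_fst measurable_id).symm
  have h₂ := indepFun_prodMk_right_comm (by fun_prop) (by fun_prop) (by fun_prop) h₁
    (indepFun_input_noise S σ.V (t + 1))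
  have hφ : Measurable fun p : Vec (n (t + 1)) × Vec (n t) =>
    Matrix.toEuclideanLin (S.A t) p.2 + p.1 := by fun_prop
  have h₃ := h₂.comp hφ measurable_id
  have e : σ.predError S t = (fun p : Vec (n (t + 1)) × Vec (n t) =>
    Matrix.toEuclideanLin (S.A t) p.2 + p.1) ∘ fun ω => (ω.1 (t + 1), σ.error S t ω) := rfl
  rw [e]
  exact h₃

/-- The current error is independent of the observations, and the inputs at time `t + 1` are
independent of both. -/
theorem FilterSpec.indepFun_predError {t : ℕ} (h : σ.FilterSpec S t) :
    IndepFun (fun ω => (σ.predError S t ω, ω.2 (t + 1))) (history (σ.y S) (Finset.Icc 1 t))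
      (σ.μ S) := by
  have := indepFun_prodMk_right_comm (by fun_prop) (σ.measurable_history_y S _) (by fun_prop)
    (σ.indepFun_next_error S t) h.indepFun
  have hφ : Measurable fun p : Vec (n t) × (Vec (n (t + 1)) × Vec (σ.r (t + 1))) =>
    (Matrix.toEuclideanLin (S.A t) p.1 + p.2.1, p.2.2) := by fun_prop
  exact this.comp hφ measurable_id

/-- Inside the horizon `V ≻ 0` makes the innovation covariance invertible, whence the normal
equation. -/
theorem gain_mul {t : ℕ} (h : (σ.predCov S t).PosSemidef) (ht : t < T) :
    σ.gain S (t + 1) * (σ.C (t + 1) * σ.predCov S t * (σ.C (t + 1))ᵀ + σ.V (t + 1))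
      = σ.predCov S t * (σ.C (t + 1))ᵀ := by
  have hmem : t + 1 ∈ Finset.Icc 1 T := by simp; omega
  have hpos : (σ.C (t + 1) * σ.predCov S t * (σ.C (t + 1))ᵀ + σ.V (t + 1)).PosDef :=
    Matrix.PosDef.posSemidef_add (posSemidef_mul_mul_transpose _ h) (σ.V_posDef _ hmem)
  rw [gain, gainOf, if_pos hmem, Matrix.mul_assoc, Matrix.nonsing_inv_mul _
    ((Matrix.isUnit_iff_isUnit_det _).1 hpos.isUnit), Matrix.mul_one]

/-- In the induction step, the new error is independent of the innovation by the choice of gain, and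
the pair of them is independent of `y^t`; hence the error is independent of innovation and `y^t`
together, which determine `y^{t+1}`. -/
theorem filterSpec {t : ℕ} (ht : t ≤ T) : σ.FilterSpec S t := by
  induction t with
  | zero =>
    have e : σ.error S 0 = fun ω => ω.1 0 := by
      ext ω i
      simp [error, estimate, filter, Source.x]
    refine ⟨S.P₀_posDef.posSemidef, ?_, ?_⟩
    · rw [e]
      exact map_input S σ.V 0
    · have : history (σ.y S) (Finset.Icc 1 0) = fun _ => fun s => 0 := by
        ext ω s
        exact absurd s.2 (by simp)
      rw [this]
      exact (indepFun_const_left _ _).symm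
  | succ t ih =>
    have h := ih (by omega)
    have htT : t < T := by omega
    have hmem : t + 1 ∈ Finset.Icc 1 T := by simp; omega
    have hP := h.posSemidef_predCov htT
    have hV := σ.V_posDef _ hmem
    refine ⟨?_, ?_, ?_⟩
    · rw [errCov_succ]
      exact (posSemidef_mul_mul_transpose _ hP).add (posSemidef_mul_mul_transpose _ hV.posSemidef)
    · have := map_add_multivariateGaussian (1 - σ.gain S (t + 1) * σ.C (t + 1))
        (-σ.gain S (t + 1)) hP hV.posSemidef (by fun_prop) (by fun_prop) (h.map_predError htT)
        (map_noise S σ.V (t + 1)) (FilterSpec.indepFun_predError_noise t)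
      rw [errCov_succ, ← this]
      congr 1
      ext1 ω
      exact σ.error_succ' S t ω
    · have hinn := indepFun_error_innovation hP hV (σ.C (t + 1)) (gain_mul hP htT)
        (by fun_prop) (by fun_prop) (h.map_predError htT) (map_noise S σ.V (t + 1))
        (FilterSpec.indepFun_predError_noise t)
      simp_rw [← error_succ] at hinn
      have hpair : IndepFun (fun ω => (Matrix.toEuclideanLin (σ.C (t + 1)) (σ.predError S t ω)
          + ω.2 (t + 1), σ.error S (t + 1) ω)) (history (σ.y S) (Finset.Icc 1 t)) (σ.μ S) := by
        have := h.indepFun_predError.comp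
          (φ := fun p => (Matrix.toEuclideanLin (σ.C (t + 1)) p.1 + p.2,
            p.1 - Matrix.toEuclideanLin (σ.gain S (t + 1))
              (Matrix.toEuclideanLin (σ.C (t + 1)) p.1 + p.2))) (ψ := id)
          (by fun_prop) measurable_id
        convert! this using 1
        ext1 ω
        simp [error_succ]
      have hfin := indepFun_prodMk_right_comm (by fun_prop) (by fun_prop)
        (σ.measurable_history_y S _) hpair hinn.symm
      -- Rebuilds `y^{t+1}` from the innovation and `y^t`: the last entry is the predicted output
      -- plus the innovation.
      let G : Vec (σ.r (t + 1)) × ((s : Finset.Icc 1 t) → Vec (σ.r s)) →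
          (s : Finset.Icc 1 (t + 1)) → Vec (σ.r s) := fun p s =>
        Function.update (extendZero _ p.2) (t + 1)
          (Matrix.toEuclideanLin (σ.C (t + 1)) (Matrix.toEuclideanLin (S.A t)
            (σ.filter S (extendZero _ p.2) t)) + p.1) s.1
      have hG : Measurable G := by
        refine measurable_pi_lambda _ fun s => ?_
        by_cases hs : s.1 = t + 1
        · obtain ⟨s, hs'⟩ := s
          obtain rfl : s = t + 1 := hs
          simp only [G, Function.update_self]
          fun_prop
        · simp only [G, Function.update_of_ne hs]
          fun_prop
      have := (hfin.comp (φ := G) (ψ := id) hG measurable_id).symm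
      convert! this using 1
      ext1 ω
      ext1 ⟨s, hs⟩
      by_cases hs' : s = t + 1
      · subst hs'
        simp only [Function.comp, G, Function.update_self]
        rw [← estimate_eq_filter_extendZero, ← y_succ_eq]
        rfl
      · simp only [Function.comp, G, Function.update_of_ne hs']
        rw [extendZero_history]
        · rfl
        · simp at hs ⊢; omega

variable (S σ) in
/-- The conditional mean is computed by the Kalman filter. -/
theorem z_ae_eq_estimate {t : ℕ} (ht : t ≤ T) : σ.z S t =ᵐ[σ.μ S] σ.estimate S t := by
  have h := filterSpec (S := S) (σ := σ) ht
  have hm := (σ.measurable_history_y S (Finset.Icc 1 t)).comap_le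
  have hi : Integrable (σ.error S t) (σ.μ S) := by
    have : Integrable id ((σ.μ S).map (σ.error S t)) := by
      rw [h.map_error]; exact IsGaussian.integrable_id
    exact (integrable_map_measure aestronglyMeasurable_id (by fun_prop)).1 this
  have h0 : ∫ ω, σ.error S t ω ∂(σ.μ S) = 0 := by
    have : ∫ x, x ∂((σ.μ S).map (σ.error S t)) = 0 := by
      rw [h.map_error]; exact integral_id_multivariateGaussian
    rwa [integral_map (by fun_prop) (by fun_prop)] at this
  have hsm : StronglyMeasurable[MeasurableSpace.comap (history (σ.y S) (Finset.Icc 1 t))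
      inferInstance] (σ.estimate S t) := by
    have e : σ.estimate S t = (fun h => σ.filter S (extendZero _ h) t)
        ∘ history (σ.y S) (Finset.Icc 1 t) := by
      ext1 ω
      exact σ.estimate_eq_filter_extendZero S t ω
    rw [e]
    have hmeas : Measurable fun h : (s : Finset.Icc 1 t) → Vec (σ.r s) =>
      σ.filter S (extendZero _ h) t := by fun_prop
    exact (hmeas.comp (comap_measurable _)).stronglyMeasurable
  -- The first summand is measurable in the observations; the second is centred and independent of
  -- them, so its conditional mean is zero.
  have hx : S.x t = σ.estimate S t + σ.error S t := by
    ext1 ω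
    simp [error]
  have he : Integrable (σ.estimate S t) (σ.μ S) := by
    have := (integrable_state S σ.V t).sub hi
    rwa [hx, add_sub_cancel_right] at this
  have h₁ : (σ.μ S)[σ.error S t | MeasurableSpace.comap (history (σ.y S) (Finset.Icc 1 t))
      inferInstance] =ᵐ[σ.μ S] fun _ => 0 := by
    rw [← h0]
    exact condExp_indep_eq (σ.measurable_error S t).comap_le hm
      (comap_measurable _).stronglyMeasurable h.indepFun
  have h₂ := condExp_add he hi (MeasurableSpace.comap (history (σ.y S) (Finset.Icc 1 t))
      inferInstance)
  rw [condExp_of_stronglyMeasurable hm hsm he, ← hx] at h₂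
  filter_upwards [h₁, h₂] with ω h₁ h₂
  rw [z, h₂, Pi.add_apply, h₁, add_zero]

end Filter

end Sensor

-- From a sensor to a reproduction kernel.

/-- The instance of `condMutualInfo_le` in which `(X, Y)` is a function of `Z'` and of a variable
independent of `Z`. -/
theorem condMutualInfo_le_of_innovation {Ω α β β' κ κ' δ : Type*} [MeasurableSpace Ω]
    [MeasurableSpace α] [MeasurableSpace β] [MeasurableSpace β'] [MeasurableSpace κ]
    [MeasurableSpace κ'] [MeasurableSpace δ] {μ : Measure Ω} [IsProbabilityMeasure μ]
    [StandardBorelSpace α] [Nonempty α] [StandardBorelSpace β] [Nonempty β]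
    [StandardBorelSpace β'] [Nonempty β'] [StandardBorelSpace δ] [Nonempty δ]
    {X : Ω → α} {Y : Ω → β} {Y' : Ω → β'} {Z : Ω → κ} {Z' : Ω → κ'} {U : Ω → δ}
    (hX : Measurable X) (hY : Measurable Y) (hZ : Measurable Z) (hU : Measurable U)
    (hUZ : IndepFun U Z μ) {φ : κ → κ'} (hφ : Measurable φ) (hZ' : ∀ ω, Z' ω = φ (Z ω))
    {f : κ' × δ → α × β} (hf : Measurable f) (hXY : ∀ ω, (X ω, Y ω) = f (Z' ω, U ω))
    {h : κ' × β → β'} (hh : Measurable h) (hY' : ∀ ω, Y' ω = h (Z' ω, Y ω)) :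
    condMutualInfo μ X Y' Z' ≤ condMutualInfo μ X Y Z := by
  have := Measure.isProbabilityMeasure_map (μ := μ) hU.aemeasurable
  have hc : condDistrib U Z μ =ᵐ[μ.map Z] Kernel.const κ (μ.map U) := by
    refine condDistrib_ae_eq_of_measure_eq_compProd Z hU.aemeasurable ?_
    rw [Measure.compProd_const]
    exact (indepFun_iff_map_prod_eq_prod_map_map hZ.aemeasurable hU.aemeasurable).1 hUZ.symm
  have hd := condDistrib_comp_prodMk (μ := μ) hZ hU (f := fun p : κ × δ => f (φ p.1, p.2))
    (by fun_prop)
  refine condMutualInfo_le hX hY hZ hφ (.of_forall hZ')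
    (η := (Kernel.id ×ₖ Kernel.const κ' (μ.map U)).map f) ?_ hh (.of_forall hY')
  have e : (fun ω => (X ω, Y ω)) = fun ω => f (φ (Z ω), U ω) := by
    ext1 ω
    rw [hXY, hZ']
  rw [e]
  filter_upwards [hc, hd] with c h₁ h₂
  rw [h₂, h₁, Kernel.map_apply _ hf, Kernel.prod_apply, Kernel.id_apply, Kernel.const_apply,
    Kernel.const_apply, Measure.dirac_prod, Measure.map_map hf (by fun_prop)]
  rfl

instance instStandardBorelSpaceVec (k : ℕ) : StandardBorelSpace (Vec k) :=
  standardBorel_of_polish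

theorem Ico_one_succ (t : ℕ) : Finset.Ico 1 (t + 1) = Finset.Icc 1 t := by
  ext s
  simp

namespace LinearGaussianKernel

variable {T : ℕ} {n : ℕ → ℕ} (S : Source T n) (γ : LinearGaussianKernel T n)

@[fun_prop]
theorem measurable_z (t : ℕ) : Measurable (γ.z S t) := by
  induction t using Nat.strong_induction_on with
  | _ t ih =>
    have e : γ.z S t = fun ω => Matrix.toEuclideanLin (γ.E t) (S.x t ω)
      + ∑ s ∈ Finset.Ico 1 t, Matrix.toEuclideanLin (γ.F t s) (γ.z S s ω) + ω.2 t :=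
      funext (γ.z_eq S t)
    rw [e]
    have : Measurable fun ω : Sample n n =>
        ∑ s ∈ Finset.Ico 1 t, Matrix.toEuclideanLin (γ.F t s) (γ.z S s ω) :=
      Finset.measurable_sum _ fun s hs =>
        (measurable_toEuclideanLin _).comp (ih s (Finset.mem_Ico.1 hs).2)
    fun_prop

theorem measurable_history_z (I : Finset ℕ) : Measurable (history (γ.z S) I) :=
  measurable_history fun t _ => γ.measurable_z S t

end LinearGaussianKernel

namespace Sensor

variable {T : ℕ} {n : ℕ → ℕ} (S : Source T n) (σ : Sensor T n)

theorem gain_mul_V_posSemidef {t : ℕ} (ht : t ∈ Finset.Icc 1 T) :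
    (σ.gain S t * σ.V t * (σ.gain S t)ᵀ).PosSemidef :=
  posSemidef_mul_mul_transpose _ (σ.V_posDef t ht).posSemidef

/-- The dependence of the Kalman estimate at time `t` on that at time `s`. -/
noncomputable def feedback : (t s : ℕ) → Matrix (Fin (n t)) (Fin (n s)) ℝ
  | 0, _ => 0
  -- In `A z + K (C x + v - C A z)` only the latest estimate is fed back, with matrix `(1 - K C) A`;
  -- the cast identifies the index types along `s = t`.
  | t + 1, s => if h : s = t then
      ((1 - σ.gain S (t + 1) * σ.C (t + 1)) * S.A t).submatrix id (Fin.cast (congrArg n h))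
    else 0

/-- The linear-Gaussian kernel that reproduces the Kalman estimates. -/
noncomputable def kernel : LinearGaussianKernel T n where
  E t := σ.gain S t * σ.C t
  F := σ.feedback S
  G t := σ.gain S t * σ.V t * (σ.gain S t)ᵀ
  G_posSemidef _ ht := σ.gain_mul_V_posSemidef S ht

/-- The sample point of the reproduction kernel that corresponds to one of the sensor. -/
noncomputable def toKernelSample (ω : Sample n σ.r) : Sample n n :=
  (ω.1, fun t => Matrix.toEuclideanLin (σ.gain S t) (ω.2 t))

@[fun_prop]
theorem measurable_toKernelSample : Measurable (σ.toKernelSample S) := by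
  unfold toKernelSample
  fun_prop

theorem map_toKernelSample : (σ.μ S).map (σ.toKernelSample S) = (σ.kernel S).μ S := by
  refine map_noiseMeasure S σ.V _ (σ.gain S) fun t => ?_
  by_cases ht : t ∈ Finset.Icc 1 T
  · exact map_toEuclideanLin_multivariateGaussian _ (σ.V_posDef t ht).posSemidef
  -- Off the horizon the gain vanishes and both sides are the point mass at `0`.
  · have hG : (σ.kernel S).G t = 0 := by simp [kernel, σ.gain_of_notMem S ht]
    have h0 : ⇑(Matrix.toEuclideanLin (0 : Matrix (Fin (n t)) (Fin (σ.r t)) ℝ)) = fun _ => 0 := by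
      ext x i
      simp
    rw [hG, multivariateGaussian_zero_zero, σ.gain_of_notMem S ht, h0, Measure.map_const]
    simp

/-- For `t = 0` the sum is empty, which is why `z 0` has to vanish. -/
theorem sum_feedback (t : ℕ) (z : (s : ℕ) → Vec (n s)) (h : t = 0 → z t = 0) :
    ∑ s ∈ Finset.Ico 1 (t + 1), Matrix.toEuclideanLin (σ.feedback S (t + 1) s) (z s)
      = Matrix.toEuclideanLin ((1 - σ.gain S (t + 1) * σ.C (t + 1)) * S.A t) (z t) := by
  have e : Matrix.toEuclideanLin (σ.feedback S (t + 1) t) (z t)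
      = Matrix.toEuclideanLin ((1 - σ.gain S (t + 1) * σ.C (t + 1)) * S.A t) (z t) := by
    simp only [feedback, dite_true]
    rfl
  rw [← e]
  refine Finset.sum_eq_single t (fun s _ hs => ?_) fun ht => ?_
  · simp [feedback, hs]
  · rw [h (by simp at ht; omega), map_zero]

theorem kernel_z_toKernelSample {t : ℕ} (ht : 1 ≤ t) (ω : Sample n σ.r) :
    (σ.kernel S).z S t (σ.toKernelSample S ω) = σ.estimate S t ω := by
  induction t using Nat.strong_induction_on with
  | _ t ih =>
    obtain ⟨t, rfl⟩ : ∃ u, t = u + 1 := ⟨t - 1, by omega⟩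
    have hx : S.x (t + 1) (σ.toKernelSample S ω) = S.x (t + 1) ω := state_congr S fun _ _ => rfl
    have hsum : ∑ s ∈ Finset.Ico 1 (t + 1), Matrix.toEuclideanLin ((σ.kernel S).F (t + 1) s)
          ((σ.kernel S).z S s (σ.toKernelSample S ω))
        = ∑ s ∈ Finset.Ico 1 (t + 1), Matrix.toEuclideanLin (σ.feedback S (t + 1) s)
          (σ.estimate S s ω) :=
      Finset.sum_congr rfl fun s hs => by
        rw [ih s (Finset.mem_Ico.1 hs).2 (Finset.mem_Ico.1 hs).1]; rfl
    have h1 : Matrix.toEuclideanLin (1 : Matrix (Fin (n (t + 1))) (Fin (n (t + 1))) ℝ)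
        (Matrix.toEuclideanLin (S.A t) (σ.estimate S t ω))
        = Matrix.toEuclideanLin (S.A t) (σ.estimate S t ω) := by ext i; simp
    rw [LinearGaussianKernel.z_eq, hx, hsum, sum_feedback S σ t (fun s => σ.estimate S s ω)
      (by rintro rfl; rfl), estimate_succ, y]
    change Matrix.toEuclideanLin (σ.gain S (t + 1) * σ.C (t + 1)) (S.x (t + 1) ω) + _
      + Matrix.toEuclideanLin (σ.gain S (t + 1)) (ω.2 (t + 1)) = _
    simp only [map_sub, map_add, LinearMap.sub_apply, toEuclideanLin_mul_apply, h1]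
    abel

theorem state_toKernelSample (t : ℕ) (ω : Sample n σ.r) :
    S.x t (σ.toKernelSample S ω) = S.x t ω := state_congr S fun _ _ => rfl

theorem kernel_law : (σ.kernel S).law S = σ.law S := by
  have h₁ : Measurable (history (S.x (d := n)) (Finset.Icc 0 T)) :=
    measurable_history fun t _ => measurable_state S t
  have h₂ := (σ.kernel S).measurable_history_z S (Finset.Icc 1 T)
  rw [LinearGaussianKernel.law, law, jointLaw, jointLaw, ← map_toKernelSample,
    Measure.map_map (by fun_prop) (by fun_prop)]
  refine Measure.map_congr ?_
  have hz : ∀ᵐ ω ∂(σ.μ S), ∀ s : Finset.Icc 1 T, σ.z S s ω = σ.estimate S s ω :=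
    ae_all_iff.2 fun s => σ.z_ae_eq_estimate S (Finset.mem_Icc.1 s.2).2
  filter_upwards [hz] with ω hω
  have e₁ : history S.x (Finset.Icc 0 T) (σ.toKernelSample S ω)
      = history S.x (Finset.Icc 0 T) ω := funext fun s => σ.state_toKernelSample S s.1 ω
  have e₂ : history ((σ.kernel S).z S) (Finset.Icc 1 T) (σ.toKernelSample S ω)
      = history (σ.z S) (Finset.Icc 1 T) ω := funext fun s =>
    (σ.kernel_z_toKernelSample S (Finset.mem_Icc.1 s.2).1 ω).trans (hω s).symm
  rw [Function.comp, e₁, e₂]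

theorem dist_eq_lintegral_error {Θ : (t : ℕ) → Matrix (Fin (n t)) (Fin (n t)) ℝ} {t : ℕ}
    (ht : t ≤ T) : σ.dist S Θ t
      = ∫⁻ ω, ENNReal.ofReal (weightedSq (Θ t) (σ.error S t ω)) ∂(σ.μ S) := by
  refine lintegral_congr_ae ?_
  filter_upwards [σ.z_ae_eq_estimate S ht] with ω hω
  rw [hω, error]

theorem kernel_dist {Θ : (t : ℕ) → Matrix (Fin (n t)) (Fin (n t)) ℝ} {t : ℕ}
    (ht : t ∈ Finset.Icc 1 T) : (σ.kernel S).dist S Θ t = σ.dist S Θ t := by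
  rw [dist_eq_lintegral_error S σ (Finset.mem_Icc.1 ht).2, LinearGaussianKernel.dist, distortion,
    ← map_toKernelSample, lintegral_map (by fun_prop) (by fun_prop)]
  refine lintegral_congr fun ω => ?_
  rw [kernel_z_toKernelSample S σ (Finset.mem_Icc.1 ht).1, state_toKernelSample, error]

/-- The state and output at time `t + 1` are functions of the last estimate and of the prediction
error and fresh noise, which are independent of `y^t`; the next estimate is a function of the last
one and the output. -/
theorem kernel_cost_le : (σ.kernel S).cost S ≤ σ.cost S := by
  unfold LinearGaussianKernel.cost cost informationCost
  refine Finset.sum_le_sum fun t ht => ?_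
  obtain ⟨t, rfl⟩ : ∃ u, t = u + 1 := ⟨t - 1, by simp at ht; omega⟩
  have htT : t < T := by simp at ht; omega
  rw [Ico_one_succ]
  have hz := (σ.kernel S).measurable_history_z S (Finset.Icc 1 t)
  have e : condMutualInfo ((σ.kernel S).μ S) (S.x (t + 1)) ((σ.kernel S).z S (t + 1))
        (history ((σ.kernel S).z S) (Finset.Icc 1 t))
      = condMutualInfo (σ.μ S) (S.x (t + 1)) (σ.estimate S (t + 1))
        (history (σ.estimate S) (Finset.Icc 1 t)) := by
    have := condMutualInfo_map (μ := σ.μ S) (σ.measurable_toKernelSample S)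
      (measurable_state S (t + 1)) ((σ.kernel S).measurable_z S (t + 1)) hz
    simp_rw [map_toKernelSample] at this
    rw [this]
    congr 1
    · ext1 ω
      exact σ.state_toKernelSample S _ ω
    · ext1 ω
      exact σ.kernel_z_toKernelSample S (by omega) ω
    · ext1 ω
      exact funext fun s => σ.kernel_z_toKernelSample S (Finset.mem_Icc.1 s.2).1 ω
  rw [e]
  -- The predicted state. For `t = 0` the history is empty and `extendZero` supplies the initial
  -- estimate `0`.
  let m : ((s : Finset.Icc 1 t) → Vec (n s)) → Vec (n (t + 1)) := fun h =>
    Matrix.toEuclideanLin (S.A t) (extendZero _ h t)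
  have hm : Measurable m := by
    simp only [m]
    fun_prop
  have hmz : ∀ ω, m (history (σ.estimate S) (Finset.Icc 1 t) ω)
      = Matrix.toEuclideanLin (S.A t) (σ.estimate S t ω) := fun ω => by
    rcases Nat.eq_zero_or_pos t with rfl | h
    · simp [m, extendZero, estimate, filter]
    · simp only [m]
      rw [extendZero_history _ (by simp; omega)]
  refine condMutualInfo_le_of_innovation (by fun_prop) (by fun_prop) (σ.measurable_history_y S _)
    (U := fun ω => (σ.predError S t ω, ω.2 (t + 1))) (by fun_prop)
    (filterSpec (by omega)).indepFun_predError
    (φ := fun h s => σ.filter S (extendZero _ h) s.1) (by fun_prop) (fun ω => ?_)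
    (f := fun p => (m p.1 + p.2.1, Matrix.toEuclideanLin (σ.C (t + 1)) (m p.1)
      + (Matrix.toEuclideanLin (σ.C (t + 1)) p.2.1 + p.2.2))) (by fun_prop) (fun ω => ?_)
    (h := fun p => m p.1 + Matrix.toEuclideanLin (σ.gain S (t + 1))
      (p.2 - Matrix.toEuclideanLin (σ.C (t + 1)) (m p.1))) (by fun_prop) (fun ω => ?_)
  · ext1 s
    refine σ.filter_congr S fun u hu => (extendZero_history (σ.y S) ?_ ω).symm
    have := s.2
    simp only [Finset.mem_Icc] at hu this ⊢
    omega
  · rw [hmz, ← y_succ_eq, ← state_succ_eq]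
  · rw [hmz, estimate_succ]

end Sensor

-- Finite information excludes noiseless observation.

/-- Conditional mutual information is infinite if `(X, Y)` satisfies a relation, given `Z`, that has
conditional probability zero in `X` for every fixed value of `Y`. -/
theorem condMutualInfo_eq_top {Ω α β κ : Type*} [MeasurableSpace Ω] [MeasurableSpace α]
    [MeasurableSpace β] [MeasurableSpace κ] {μ : Measure Ω} [IsProbabilityMeasure μ]
    [StandardBorelSpace α] [Nonempty α] [StandardBorelSpace β] [Nonempty β]
    {X : Ω → α} {Y : Ω → β} {Z : Ω → κ} (hX : Measurable X) (hY : Measurable Y)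
    (hZ : Measurable Z) {B : Set (κ × (α × β))} (hB : MeasurableSet B)
    (hmem : ∀ᵐ ω ∂μ, (Z ω, (X ω, Y ω)) ∈ B)
    (hnull : ∀ᵐ c ∂(μ.map Z), ∀ y, condDistrib X Z μ c {x | (c, (x, y)) ∈ B} = 0) :
    condMutualInfo μ X Y Z = ⊤ := by
  have := Measure.isProbabilityMeasure_map (μ := μ) hZ.aemeasurable
  have h₁ : ∀ᵐ c ∂(μ.map Z), ∀ᵐ p ∂(condDistrib (fun ω => (X ω, Y ω)) Z μ c), (c, p) ∈ B := by
    refine Measure.ae_ae_of_ae_compProd (p := fun q => q ∈ B) ?_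
    rw [compProd_map_condDistrib (mβ := inferInstance) (by fun_prop)]
    exact (ae_map_iff (p := fun q => q ∈ B) (by fun_prop) hB).2 hmem
  unfold condMutualInfo
  have h₂ : ∀ᵐ c ∂(μ.map Z), klDiv (condDistrib (fun ω => (X ω, Y ω)) Z μ c)
      ((condDistrib X Z μ c).prod (condDistrib Y Z μ c)) = ⊤ := by
    filter_upwards [h₁, hnull] with c hc hn
    -- The section of `B` has full measure for the joint conditional law, yet is null for the
    -- product, as one sees by integrating in `x` for fixed `y`.
    refine klDiv_of_not_ac fun hac => ?_
    have hBc : MeasurableSet (Prod.mk c ⁻¹' B) := measurable_prodMk_left hB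
    have h0 : ((condDistrib X Z μ c).prod (condDistrib Y Z μ c)) (Prod.mk c ⁻¹' B) = 0 := by
      rw [Measure.prod_apply_symm hBc]
      exact (lintegral_congr fun y => hn y).trans lintegral_zero
    have h3 := hac h0
    have h4 : (condDistrib (fun ω => (X ω, Y ω)) Z μ c) (Prod.mk c ⁻¹' B)ᶜ = 0 := hc
    have h5 := measure_univ (μ := condDistrib (fun ω => (X ω, Y ω)) Z μ c)
    rw [← Set.union_compl_self (Prod.mk c ⁻¹' B)] at h5
    have h6 := measure_union_le (μ := condDistrib (fun ω => (X ω, Y ω)) Z μ c)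
      (Prod.mk c ⁻¹' B) (Prod.mk c ⁻¹' B)ᶜ
    rw [h3, h4, h5] at h6
    simp at h6
  rw [lintegral_congr_ae h₂]
  simp

/-- The conditional law of `A U + N` given `Z` does not charge hyperplanes when `N` is a
nondegenerate Gaussian vector independent of `(Z, U)`. -/
theorem condDistrib_hyperplane {Ω κ : Type*} [MeasurableSpace Ω] [MeasurableSpace κ]
    {μ : Measure Ω} [IsProbabilityMeasure μ] {m n : ℕ} {Z : Ω → κ} {U : Ω → Vec n} {N : Ω → Vec m}
    (hZ : Measurable Z) (hU : Measurable U) (hN : Measurable N)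
    (hi : IndepFun (fun ω => (Z ω, U ω)) N μ) {W : Matrix (Fin m) (Fin m) ℝ} (hW : W.PosDef)
    (hNW : μ.map N = multivariateGaussian 0 W) (A : Matrix (Fin m) (Fin n) ℝ) {b : Vec m}
    (hb : b ≠ 0) :
    ∀ᵐ c ∂(μ.map Z), ∀ s : ℝ,
      condDistrib (fun ω => Matrix.toEuclideanLin A (U ω) + N ω) Z μ c {x | inner ℝ b x = s} = 0 := by
  have h₁ := condDistrib_prodMk_of_indepFun hZ hU hN hi
  have h₂ := condDistrib_comp_prodMk (μ := μ) hZ (U := fun ω => (U ω, N ω)) (by fun_prop)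
    (f := fun p : κ × (Vec n × Vec m) => Matrix.toEuclideanLin A p.2.1 + p.2.2) (by fun_prop)
  filter_upwards [h₁, h₂] with c h₁ h₂ s
  have hs : MeasurableSet {x : Vec m | inner ℝ b x = s} :=
    measurableSet_eq_fun (by fun_prop) (by fun_prop)
  rw [h₂, h₁, hNW, Measure.map_apply (by fun_prop) hs,
    Measure.prod_apply (hs.preimage (by fun_prop))]
  refine (lintegral_congr fun u => ?_).trans lintegral_zero
  have e : Prod.mk u ⁻¹' ((fun p : Vec n × Vec m => Matrix.toEuclideanLin A p.1 + p.2) ⁻¹'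
      {x : Vec m | inner ℝ b x = s})
      = {x : Vec m | inner ℝ b x = s - inner ℝ b (Matrix.toEuclideanLin A u)} := by
    ext x
    simp only [Set.mem_preimage, Set.mem_ofPred_eq, inner_add_right]
    constructor <;> intro h <;> linarith
  exact (congrArg _ e).trans (multivariateGaussian_hyperplane hW hb _)

namespace LinearGaussianKernel

variable {T : ℕ} {n : ℕ → ℕ} (S : Source T n) (γ : LinearGaussianKernel T n)

theorem z_congr {ω ω' : Sample n n} {t : ℕ} (h₁ : ∀ s ≤ t, ω.1 s = ω'.1 s)
    (h₂ : ∀ s ≤ t, ω.2 s = ω'.2 s) : γ.z S t ω = γ.z S t ω' := by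
  induction t using Nat.strong_induction_on with
  | _ t ih =>
    rw [z_eq, z_eq, state_congr S h₁, h₂ t le_rfl]
    congr 2
    refine Finset.sum_congr rfl fun s hs => ?_
    have := (Finset.mem_Ico.1 hs).2
    rw [ih s this (fun u hu => h₁ u (by omega)) (fun u hu => h₂ u (by omega))]

/-- Finite cost forces every noiseless direction of the reproduction to carry no information. -/
theorem mul_E_eq_zero (hcost : γ.cost S < ⊤) {t : ℕ} (ht : t ∈ Finset.Icc 1 T) {k : ℕ}
    {M : Matrix (Fin k) (Fin (n t)) ℝ} (hM : M * γ.G t = 0) : M * γ.E t = 0 := by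
  have hfin : condMutualInfo (γ.μ S) (S.x t) (γ.z S t) (history (γ.z S) (Finset.Ico 1 t)) ≠ ⊤ := by
    unfold cost informationCost at hcost
    exact (ENNReal.sum_lt_top.1 hcost t ht).ne
  obtain ⟨t, rfl⟩ : ∃ u, t = u + 1 := ⟨t - 1, by simp at ht; omega⟩
  have htT : t < T := by simp at ht; omega
  rw [Ico_one_succ] at hfin
  by_contra hne
  obtain ⟨i, j, hij⟩ : ∃ i j, (M * γ.E (t + 1)) i j ≠ 0 := by
    by_contra! h
    exact hne (by ext i j; exact h i j)
  -- A row of `M` sees no noise but, through `b = Eᵀ a ≠ 0`, sees the state.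
  let a : Vec (n (t + 1)) := WithLp.toLp 2 (M i)
  let b : Vec (n (t + 1)) := Matrix.toEuclideanLin (γ.E (t + 1))ᵀ a
  have hb : b ≠ 0 := fun h => hij (by
    have := congrArg (fun v : Vec (n (t + 1)) => v j) h
    simpa [b, a, mulVec, dotProduct, Matrix.mul_apply, mul_comm] using this)
  have hg : ∀ᵐ ω ∂(γ.μ S), inner ℝ a (ω.2 (t + 1)) = 0 := by
    have := multivariateGaussian_ae_eq_zero (γ.G_posSemidef _ ht) hM
    rw [← map_noise S γ.G (t + 1)] at this
    filter_upwards [ae_of_ae_map (by fun_prop) this] with ω hω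
    have := congrArg (fun v : Vec k => v i) hω
    rw [inner_eq_dotProduct]
    simpa [mulVec, a] using this
  let R : ((s : Finset.Icc 1 t) → Vec (n s)) → Vec (n (t + 1)) := fun h =>
    ∑ s ∈ Finset.Icc 1 t, Matrix.toEuclideanLin (γ.F (t + 1) s) (extendZero _ h s)
  have hR : Measurable R := by
    simp only [R]
    fun_prop
  have hRz : ∀ ω, R (history (γ.z S) (Finset.Icc 1 t) ω)
      = ∑ s ∈ Finset.Icc 1 t, Matrix.toEuclideanLin (γ.F (t + 1) s) (γ.z S s ω) := fun ω =>
    Finset.sum_congr rfl fun s hs => by rw [extendZero_history _ hs]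
  have hZ := γ.measurable_history_z S (Finset.Icc 1 t)
  -- After subtracting the feedback `R`, the reproduction reveals `⟨b, x⟩` exactly, because `⟨a, g⟩
  -- = 0` almost surely.
  refine hfin (condMutualInfo_eq_top (by fun_prop) (by fun_prop) hZ
    (B := {p | inner ℝ a (p.2.2 - R p.1) = inner ℝ b p.2.1})
    (measurableSet_eq_fun (by fun_prop) (by fun_prop)) ?_ ?_)
  · filter_upwards [hg] with ω hω
    rw [hRz, z_eq, Ico_one_succ]
    simp only [inner_sub_right, inner_add_right, hω, b, ← inner_toEuclideanLin]
    ring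
  · have hind : IndepFun (fun ω => (history (γ.z S) (Finset.Icc 1 t) ω, S.x t ω))
        (fun ω => ω.1 (t + 1)) (γ.μ S) := by
      have := indepFun_next S γ.G
        (f := fun ω => (history (γ.z S) (Finset.Icc 1 t) ω, S.x t ω)) (by fun_prop) t
        fun ω ω' h₁ h₂ => by
          have e : history (γ.z S) (Finset.Icc 1 t) ω = history (γ.z S) (Finset.Icc 1 t) ω' :=
            funext fun s => by
              have hs := (Finset.mem_Icc.1 s.2).2
              exact γ.z_congr S (fun u hu => h₁ u (hu.trans hs)) (fun u hu => h₂ u (hu.trans hs))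
          simp only [e, state_congr S h₁]
      exact this.comp measurable_id measurable_fst
    -- The process noise is independent of the past and nondegenerate. The exceptional null set
    -- serves all levels at once, so the level may depend on `y`.
    have := condDistrib_hyperplane hZ (by fun_prop) (by fun_prop) hind (S.W_posDef t htT)
      (map_input S γ.G (t + 1)) (S.A t) hb
    filter_upwards [this] with c hc y
    have h := hc (inner ℝ a (y - R c))
    simp_rw [eq_comm (b := inner ℝ a (y - R c))] at h
    exact h

-- From a reproduction kernel to a sensor.

variable {r : ℕ → ℕ} (U : (t : ℕ) → Matrix (Fin (n t)) (Fin (r t)) ℝ)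

/-- The sample point of the sensor that corresponds to one of the kernel. -/
noncomputable def toSensorSample (ω : Sample n n) : Sample n r :=
  (ω.1, fun t => Matrix.toEuclideanLin (U t)ᵀ (ω.2 t))

@[fun_prop]
theorem measurable_toSensorSample : Measurable (toSensorSample U) := by
  unfold toSensorSample
  fun_prop

/-- The reproduction as a function of the sensor outputs. -/
noncomputable def reconstruct (y : (s : ℕ) → Vec (r s)) (t : ℕ) : Vec (n t) :=
  Matrix.toEuclideanLin (U t) (y t)
    + ∑ s ∈ (Finset.Ico 1 t).attach, Matrix.toEuclideanLin (γ.F t s.1) (reconstruct y s.1)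
termination_by t
decreasing_by exact (Finset.mem_Ico.1 s.2).2

theorem reconstruct_eq (y : (s : ℕ) → Vec (r s)) (t : ℕ) : γ.reconstruct U y t
    = Matrix.toEuclideanLin (U t) (y t)
      + ∑ s ∈ Finset.Ico 1 t, Matrix.toEuclideanLin (γ.F t s) (γ.reconstruct U y s) := by
  rw [reconstruct, Finset.sum_attach (Finset.Ico 1 t)
    (fun s => Matrix.toEuclideanLin (γ.F t s) (γ.reconstruct U y s))]

/-- At `t = 0` the value would be read off `y 0`, which is not an observation; hence `1 ≤ t`. -/
theorem reconstruct_congr {y y' : (s : ℕ) → Vec (r s)} {t : ℕ} (ht : 1 ≤ t)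
    (h : ∀ s ∈ Finset.Icc 1 t, y s = y' s) : γ.reconstruct U y t = γ.reconstruct U y' t := by
  induction t using Nat.strong_induction_on with
  | _ t ih =>
    rw [reconstruct_eq, reconstruct_eq, h t (by simpa using ht)]
    congr 1
    refine Finset.sum_congr rfl fun s hs => ?_
    have hs' := Finset.mem_Ico.1 hs
    rw [ih s hs'.2 hs'.1 fun u hu => h u (by simp at hu ⊢; omega)]

@[fun_prop]
theorem measurable_reconstruct (t : ℕ) : Measurable fun y => γ.reconstruct U y t := by
  induction t using Nat.strong_induction_on with
  | _ t ih =>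
    have e : (fun y => γ.reconstruct U y t) = fun y => Matrix.toEuclideanLin (U t) (y t)
        + ∑ s ∈ Finset.Ico 1 t, Matrix.toEuclideanLin (γ.F t s) (γ.reconstruct U y s) :=
      funext fun y => γ.reconstruct_eq U y t
    rw [e]
    have : Measurable fun y => ∑ s ∈ Finset.Ico 1 t,
        Matrix.toEuclideanLin (γ.F t s) (γ.reconstruct U y s) :=
      Finset.measurable_sum _ fun s hs =>
        (measurable_toEuclideanLin _).comp (ih s (Finset.mem_Ico.1 hs).2)
    fun_prop

theorem state_toSensorSample (t : ℕ) (ω : Sample n n) :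
    S.x t (toSensorSample U ω) = S.x t ω := state_congr S fun _ _ => rfl

variable {σ : Sensor T n} {U : (t : ℕ) → Matrix (Fin (n t)) (Fin (σ.r t)) ℝ}

theorem map_toSensorSample (hV : ∀ t, σ.V t = (U t)ᵀ * γ.G t * U t)
    (hr : ∀ t ∉ Finset.Icc 1 T, σ.r t = 0) :
    (γ.μ S).map (toSensorSample U) = σ.μ S := by
  refine map_noiseMeasure S γ.G _ (fun t => (U t)ᵀ) fun t => ?_
  by_cases ht : t ∈ Finset.Icc 1 T
  · rw [hV]
    exact map_toEuclideanLin_multivariateGaussian (U t)ᵀ (γ.G_posSemidef t ht)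
  -- Off the horizon `γ.G t` need not be positive semidefinite, but the output space is a single
  -- point.
  · have : IsEmpty (Fin (σ.r t)) := by rw [hr t ht]; infer_instance
    have := Measure.isProbabilityMeasure_map (μ := multivariateGaussian (0 : Vec (n t)) (γ.G t))
      (measurable_toEuclideanLin (U t)ᵀ).aemeasurable
    have hsub : Subsingleton (Vec (σ.r t)) := inferInstance
    refine Measure.ext fun s _ => ?_
    rcases Set.eq_empty_or_nonempty s with rfl | hs
    · simp
    · rw [hs.eq_univ, measure_univ, measure_univ]

theorem sensor_y_toSensorSample (hC : ∀ t, σ.C t = (U t)ᵀ * γ.E t) (t : ℕ) (ω : Sample n n) :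
    σ.y S t (toSensorSample U ω)
      = Matrix.toEuclideanLin (U t)ᵀ (γ.z S t ω
        - ∑ s ∈ Finset.Ico 1 t, Matrix.toEuclideanLin (γ.F t s) (γ.z S s ω)) := by
  rw [z_eq, add_right_comm, add_sub_cancel_right, map_add, ← toEuclideanLin_mul_apply]
  rw [Sensor.y, state_toSensorSample, hC]
  rfl

/-- Both `E x` and, almost surely, `g` are fixed by `U Uᵀ`, so compressing `E x + g` by `Uᵀ` loses
nothing; the feedback is restored recursively. -/
theorem z_ae_eq_reconstruct (hC : ∀ t, σ.C t = (U t)ᵀ * γ.E t)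
    (hUG : ∀ t ∈ Finset.Icc 1 T, (1 - U t * (U t)ᵀ) * γ.G t = 0)
    (hUE : ∀ t ∈ Finset.Icc 1 T, (1 - U t * (U t)ᵀ) * γ.E t = 0) :
    ∀ᵐ ω ∂(γ.μ S), ∀ t ∈ Finset.Icc 1 T,
      γ.reconstruct U (fun s => σ.y S s (toSensorSample U ω)) t = γ.z S t ω := by
  have hg : ∀ᵐ ω ∂(γ.μ S), ∀ t ∈ Finset.Icc 1 T,
      Matrix.toEuclideanLin (1 - U t * (U t)ᵀ) (ω.2 t) = 0 := by
    refine ae_all_iff.2 fun t => ?_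
    by_cases ht : t ∈ Finset.Icc 1 T
    · have := multivariateGaussian_ae_eq_zero (γ.G_posSemidef _ ht) (hUG t ht)
      rw [← map_noise S γ.G t] at this
      filter_upwards [ae_of_ae_map (by fun_prop) this] with ω hω _ using hω
    · exact .of_forall fun ω h => absurd h ht
  filter_upwards [hg] with ω hω t ht
  induction t using Nat.strong_induction_on with
  | _ t ih =>
    have hproj : ∀ v : Vec (n t), Matrix.toEuclideanLin (1 - U t * (U t)ᵀ) v = 0 →
        Matrix.toEuclideanLin (U t) (Matrix.toEuclideanLin (U t)ᵀ v) = v := fun v hv => by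
      have h1 : Matrix.toEuclideanLin (1 : Matrix (Fin (n t)) (Fin (n t)) ℝ) v = v := by
        ext i; simp
      rw [map_sub, LinearMap.sub_apply, h1, toEuclideanLin_mul_apply, sub_eq_zero] at hv
      exact hv.symm
    have hsum : ∑ s ∈ Finset.Ico 1 t, Matrix.toEuclideanLin (γ.F t s)
          (γ.reconstruct U (fun s => σ.y S s (toSensorSample U ω)) s)
        = ∑ s ∈ Finset.Ico 1 t, Matrix.toEuclideanLin (γ.F t s) (γ.z S s ω) :=
      Finset.sum_congr rfl fun s hs => by
        have h1 := Finset.mem_Ico.1 hs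
        have h2 := Finset.mem_Icc.1 ht
        rw [ih s h1.2 (by simp; omega)]
    rw [reconstruct_eq, hsum, γ.sensor_y_toSensorSample S hC, hproj, sub_add_cancel]
    rw [z_eq, add_right_comm, add_sub_cancel_right, map_add, hω t ht, ← toEuclideanLin_mul_apply,
      hUE t ht]
    simp

/-- The past outputs and past reproductions are functions of each other, almost surely, so data
processing applies with no loss in the conditioning. -/
theorem sensor_cost_le (hC : ∀ t, σ.C t = (U t)ᵀ * γ.E t)
    (hV : ∀ t, σ.V t = (U t)ᵀ * γ.G t * U t)
    (hr : ∀ t ∉ Finset.Icc 1 T, σ.r t = 0)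
    (hUG : ∀ t ∈ Finset.Icc 1 T, (1 - U t * (U t)ᵀ) * γ.G t = 0)
    (hUE : ∀ t ∈ Finset.Icc 1 T, (1 - U t * (U t)ᵀ) * γ.E t = 0) :
    σ.cost S ≤ γ.cost S := by
  unfold Sensor.cost cost informationCost
  refine Finset.sum_le_sum fun t ht => ?_
  obtain ⟨t, rfl⟩ : ∃ u, t = u + 1 := ⟨t - 1, by simp at ht; omega⟩
  have htT : t < T := by simp at ht; omega
  rw [Ico_one_succ]
  have hy := σ.measurable_history_y S (Finset.Icc 1 t)
  have hz := γ.measurable_history_z S (Finset.Icc 1 t)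
  have e := condMutualInfo_map (μ := γ.μ S) (measurable_toSensorSample U)
      (measurable_state S (t + 1)) (σ.measurable_y S (t + 1)) hy
  simp_rw [γ.map_toSensorSample S hV hr] at e
  rw [e]
  have ex : (fun ω : Sample n n => S.x (t + 1) (toSensorSample U ω)) = S.x (t + 1) :=
    funext fun ω => state_toSensorSample S U (t + 1) ω
  rw [ex]
  have hrec := γ.z_ae_eq_reconstruct S hC hUG hUE
  let φ : ((s : Finset.Icc 1 t) → Vec (n s)) → (s : Finset.Icc 1 t) → Vec (σ.r s) := fun h s =>
    Matrix.toEuclideanLin (U s.1)ᵀ (h s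
      - ∑ u ∈ Finset.Ico 1 s.1, Matrix.toEuclideanLin (γ.F s.1 u) (extendZero _ h u))
  have hφ : Measurable φ := by
    simp only [φ]
    fun_prop
  let ψ : ((s : Finset.Icc 1 t) → Vec (σ.r s)) → (s : Finset.Icc 1 t) → Vec (n s) := fun h s =>
    γ.reconstruct U (extendZero _ h) s.1
  have hψ : Measurable ψ := by
    simp only [ψ]
    fun_prop
  have hZ' : ∀ ω, history (σ.y S) (Finset.Icc 1 t) (toSensorSample U ω)
      = φ (history (γ.z S) (Finset.Icc 1 t) ω) := fun ω => by
    ext1 s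
    refine (γ.sensor_y_toSensorSample S hC s.1 ω).trans ?_
    simp only [φ]
    congr 2
    refine Finset.sum_congr rfl fun u hu => ?_
    have h1 := Finset.mem_Icc.1 s.2
    rw [extendZero_history _ (by simp at hu ⊢; omega)]
  have hψy : ∀ ω, ∀ s : Finset.Icc 1 t,
      ψ (history (σ.y S) (Finset.Icc 1 t) (toSensorSample U ω)) s
        = γ.reconstruct U (fun s => σ.y S s (toSensorSample U ω)) s.1 := fun ω s => by
    have h1 := Finset.mem_Icc.1 s.2
    refine γ.reconstruct_congr U h1.1 fun u hu => ?_
    exact extendZero_history (σ.y S) (by simp at hu ⊢; omega) _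
  have hψφ : ∀ᵐ c ∂((γ.μ S).map (history (γ.z S) (Finset.Icc 1 t))), ψ (φ c) = c := by
    have : ∀ᵐ c ∂((γ.μ S).map (history (γ.z S) (Finset.Icc 1 t))), ∀ s, ψ (φ c) s = c s := by
      refine ae_all_iff.2 fun s => ?_
      rw [ae_map_iff hz.aemeasurable (measurableSet_eq_fun (by fun_prop) (by fun_prop))]
      filter_upwards [hrec] with ω hω
      have h1 := Finset.mem_Icc.1 s.2
      rw [← hZ', hψy, hω s.1 (by simp; omega)]
      rfl
    filter_upwards [this] with c hc using funext hc
  -- Since `ψ` inverts `φ` almost everywhere, the conditional law given the past reproductions, read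
  -- through `ψ`, serves as the kernel on past outputs.
  refine condMutualInfo_le (by fun_prop) (by fun_prop) hz hφ (.of_forall hZ')
    (η := (condDistrib (fun ω => (S.x (t + 1) ω, γ.z S (t + 1) ω))
      (history (γ.z S) (Finset.Icc 1 t)) (γ.μ S)).comap ψ hψ) ?_
    (h := fun p => Matrix.toEuclideanLin (U (t + 1))ᵀ (p.2
      - ∑ u ∈ Finset.Icc 1 t, Matrix.toEuclideanLin (γ.F (t + 1) u) (extendZero _ (ψ p.1) u)))
    (by fun_prop) ?_
  · filter_upwards [hψφ] with c hc
    rw [Kernel.comap_apply, hc]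
  · filter_upwards [hrec] with ω hω
    refine (γ.sensor_y_toSensorSample S hC (t + 1) ω).trans ?_
    rw [Ico_one_succ]
    congr 2
    refine Finset.sum_congr rfl fun u hu => ?_
    have h1 := Finset.mem_Icc.1 hu
    have h2 : extendZero (Finset.Icc 1 t)
        (ψ (history (σ.y S) (Finset.Icc 1 t) (toSensorSample U ω))) u
        = ψ (history (σ.y S) (Finset.Icc 1 t) (toSensorSample U ω)) ⟨u, hu⟩ := by
      simp [extendZero, hu]
    rw [h2, hψy, hω u (by simp; omega)]

/-- The reproduction is itself an estimator from `y^t`. Its error is the Kalman error plus `H`, a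
function of `y^t` and so independent of the Kalman error. -/
theorem sensor_dist_le {Θ : (t : ℕ) → Matrix (Fin (n t)) (Fin (n t)) ℝ}
    (hC : ∀ t, σ.C t = (U t)ᵀ * γ.E t)
    (hV : ∀ t, σ.V t = (U t)ᵀ * γ.G t * U t)
    (hr : ∀ t ∉ Finset.Icc 1 T, σ.r t = 0)
    (hUG : ∀ t ∈ Finset.Icc 1 T, (1 - U t * (U t)ᵀ) * γ.G t = 0)
    (hUE : ∀ t ∈ Finset.Icc 1 T, (1 - U t * (U t)ᵀ) * γ.E t = 0) {t : ℕ}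
    (ht : t ∈ Finset.Icc 1 T) (hΘ : (Θ t).PosSemidef) :
    σ.dist S Θ t ≤ γ.dist S Θ t := by
  have htT := Finset.mem_Icc.1 ht
  let H : Sample n σ.r → Vec (n t) := fun ω =>
    σ.estimate S t ω - γ.reconstruct U (fun s => σ.y S s ω) t
  have e : γ.dist S Θ t = ∫⁻ ω, ENNReal.ofReal (weightedSq (Θ t) (σ.error S t ω + H ω))
      ∂(σ.μ S) := by
    rw [dist, distortion, ← γ.map_toSensorSample S hV hr,
      lintegral_map (by fun_prop) (by fun_prop)]
    refine lintegral_congr_ae ?_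
    filter_upwards [γ.z_ae_eq_reconstruct S hC hUG hUE] with ω hω
    simp only [Sensor.error, H]
    rw [sub_add_sub_cancel, state_toSensorSample, hω t ht]
  rw [σ.dist_eq_lintegral_error S htT.2, e]
  have hspec := Sensor.filterSpec (S := S) (σ := σ) htT.2
  refine lintegral_weightedSq_le_add hΘ hspec.posSemidef (by fun_prop) (by fun_prop)
    hspec.map_error ?_
  have hcomp : Measurable fun h : (s : Finset.Icc 1 t) → Vec (σ.r s) =>
    σ.filter S (extendZero _ h) t - γ.reconstruct U (extendZero _ h) t := by fun_prop
  have eH : H = (fun h : (s : Finset.Icc 1 t) → Vec (σ.r s) =>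
      σ.filter S (extendZero _ h) t - γ.reconstruct U (extendZero _ h) t)
      ∘ history (σ.y S) (Finset.Icc 1 t) := by
    ext1 ω
    simp only [H, Function.comp]
    rw [σ.estimate_eq_filter_extendZero, γ.reconstruct_congr U htT.1 fun s hs =>
      (extendZero_history (σ.y S) hs ω).symm]
  rw [eH]
  exact hspec.indepFun.comp measurable_id hcomp

end LinearGaussianKernel

end GaussSRD

theorem lemma2 (T : ℕ) (n : ℕ → ℕ) (S : GaussSRD.Source T n)
    (Θ : (t : ℕ) → Matrix (Fin (n t)) (Fin (n t)) ℝ)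
    (hΘ : ∀ t ∈ Finset.Icc 1 T, (Θ t).PosSemidef) (D : ℕ → ℝ) :
    (∀ γ : GaussSRD.LinearGaussianKernel T n, γ.Feasible S Θ D → γ.cost S < ⊤ →
      ∃ σ : GaussSRD.Sensor T n, σ.Feasible S Θ D ∧ σ.cost S ≤ γ.cost S ∧
        ∀ t ∈ Finset.Icc 1 T, σ.dist S Θ t ≤ γ.dist S Θ t) ∧
    (∀ σ : GaussSRD.Sensor T n, σ.Feasible S Θ D → σ.cost S < ⊤ →
      ∃ γ : GaussSRD.LinearGaussianKernel T n, γ.law S = σ.law S ∧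
        γ.Feasible S Θ D ∧ γ.cost S ≤ σ.cost S) := by
  refine ⟨fun γ hfeas hcost => ?_, fun σ hfeas _ => ?_⟩
  · have hU : ∀ t, ∃ (r : ℕ) (U : Matrix (Fin (n t)) (Fin r) ℝ),
        (t ∈ Finset.Icc 1 T → (Uᵀ * γ.G t * U).PosDef ∧ (1 - U * Uᵀ) * γ.G t = 0)
          ∧ (t ∉ Finset.Icc 1 T → r = 0) := by
      intro t
      by_cases ht : t ∈ Finset.Icc 1 T
      · obtain ⟨r, U, h₁, h₂⟩ := GaussSRD.exists_posDef_compression (γ.G_posSemidef t ht)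
        exact ⟨r, U, fun _ => ⟨h₁, h₂⟩, fun h => absurd ht h⟩
      -- Zero output dimension off the horizon, as `map_toSensorSample` requires.
      · exact ⟨0, 0, fun h => absurd h ht, fun _ => rfl⟩
    choose r U hU hr using hU
    have hUG := fun t ht => (hU t ht).2
    -- The one place where finiteness of the cost enters.
    have hUE := fun t ht => γ.mul_E_eq_zero S hcost ht (hUG t ht)
    let σ : GaussSRD.Sensor T n :=
      { r := r
        C := fun t => (U t)ᵀ * γ.E t
        V := fun t => (U t)ᵀ * γ.G t * U t
        V_posDef := fun t ht => (hU t ht).1 }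
    have hdist : ∀ t ∈ Finset.Icc 1 T, σ.dist S Θ t ≤ γ.dist S Θ t := fun t ht =>
      γ.sensor_dist_le S (σ := σ) (fun _ => rfl) (fun _ => rfl) hr hUG hUE ht (hΘ t ht)
    exact ⟨σ, fun t ht =>
      (EReal.coe_ennreal_le_coe_ennreal_iff.2 (hdist t ht)).trans (hfeas t ht),
      γ.sensor_cost_le S (σ := σ) (fun _ => rfl) (fun _ => rfl) hr hUG hUE, hdist⟩
  · refine ⟨σ.kernel S, σ.kernel_law S, fun t ht => ?_, σ.kernel_cost_le S⟩
    rw [σ.kernel_dist S ht]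
    exact hfeas t ht
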